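/- **Setting.** Let $N\ge 1$, $L\ge 0$, $n_A\ge 2$, $\varepsilon\in[0,1]$, $\alpha\in[0,1]$. Let $\{p_i\}_{i=0}^{n_A-1}$ be a probability distribution (Alice's settings) and $\{|\phi_i\rangle\}_{i=0}^{n_A-1}$ unit vectors (reference states) of a Hilbert space $\mathcal H_C$. For a setting sequence $i_1^N=(i_1,\dots,i_N)$, Alice's source emits in round $u$ the state $$|\psi^{\varepsilon}_{i_{u-L}^{u}}\rangle_{C_u}=\sqrt{1-\varepsilon}\,|\phi_{i_u}\rangle+\sqrt{\varepsilon}\,|\phi^{\perp}_{i_{u-L}^{u}}\rangle ,$$ where $|\phi^{\perp}_{i_{u-L}^{u}}\rangle$ is an unknown unit vector orthogonal to $|\phi_{i_u}\rangle$ that may depend on $u$ and on the settings $i_{u-L},\dots,i_u$ (truncated to rounds in $[1,N]$). In the entanglement-based picture Alice prepares $$|\Psi^\varepsilon\rangle_{A_1^NC_1^N}=\sum_{i_1^N}\bigotimes_{u=1}^N\sqrt{p_{i_u}}\,|i_u\rangle_{A_u}|\psi^{\varepsilon}_{i_{u-L}^{u}}\rangle_{C_u},$$ with $\{|i\rangle\}_i$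 an orthonormal basis of $\mathbb C^{n_A}$, and an arbitrary quantum channel maps $C_1^N$ to Bob's systems $B_1^N$. Let $W=\sum_\omega \omega|\omega\rangle\langle\omega|\neq 0$ be a Hermitian observable on $\mathbb C^{n_A}$, with an orthonormal eigenbasis $\{|\omega\rangle\}$. In the virtual estimation protocol each pair $A_uB_u$ is measured with the POVM $$\{(1-\alpha)p^{B}_{Z}|i_X\rangle\langle i_X|\otimes\Gamma^{b|V}\}_{i,b\in\{0,1\}}\cup\{(1-\alpha)p^{B}_\beta|i\rangle\langle i|\otimes\Gamma^{b|\beta}\}_{(i,\beta,b)\notin\mathcal K}\cup\{\alpha|\omega\rangle\langle\omega|\otimes 1\}_{\omega},$$ where $\{p^B_\beta\}$ is a probability distribution on Bob's bases $\beta\in\{Z,X_1,\dots,X_{n_M}\}$, $\{\Gamma^{b|\beta}\}_{b\in\{0,1,\perp\}}$ and $\{\Gamma^{b|V}\}_{b\in\{0,1,\perp\}}$ are POVMs with $\Gamma^{\perp|V}=\Gamma^{\perp|Z}$, $|0_X\rangle,|1_X\rangle=(|0\rangle\pm|1\rangle)/\sqrt2$, and $\mathcal K=\{(i,Z,b): i,b\in\{0,1\}\}$.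 Let $\chi_W^u=\omega$ if the outcome of round $u$ is that of $\alpha|\omega\rangle\langle\omega|\otimes 1$, and $\chi_W^u=0$ otherwise; let $M_W=\sum_{u=1}^N\chi_W^u$, and let $\omega_{\min}$, $\omega_{\max}$ be the minimum and maximum of the set consisting of $0$ and the eigenvalues of $W$. **Semidefinite programs.** Put $\varepsilon'=1-(1-\varepsilon)^{L+1}$. Let $\mathcal S_{\rm const}$ be the set of positive semidefinite $2n_A\times 2n_A$ matrices $G=\begin{pmatrix}G_\phi&G_c\\G_c^\dagger&G_\perp\end{pmatrix}$ with $[G_\phi]_{ij}=\langle\phi_i|\phi_j\rangle$, $[G_c]_{ii}=0$ and $[G_\perp]_{ii}=1$ for all $i,j$, and let $$[\rho_A^{\varepsilon'}]_{ij}=\sqrt{p_ip_j}\Big[(1-\varepsilon')[G_\phi]_{ji}+\varepsilon'[G_\perp]_{ji}+\sqrt{(1-\varepsilon')\varepsilon'}\big([G_c]_{ij}^*+[G_c]_{ji}\big)\Big].$$ Let $E^L,E^U,E_2^U$ be real numbers with $$E^L\le\alpha\min_{G\in\mathcal S_{\rm const}}\mathrm{Tr}(W\rho_A^{\varepsilon'}),\quad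 E^U\ge\alpha\max_{G\in\mathcal S_{\rm const}}\mathrm{Tr}(W\rho_A^{\varepsilon'}),\quad E_2^U\ge\alpha\max_{G\in\mathcal S_{\rm const}}\mathrm{Tr}(W^2\rho_A^{\varepsilon'}).$$ **Theorem.** Let $\epsilon_{\rm pB}>0$, $\bar N_L=\lceil N/(L+1)\rceil$, $c=\max\{\omega_{\max}-E^L,\,E^U-\omega_{\min}\}$, $V=E_2^U-\big[\max(0,E^L)+\min(0,E^U)\big]^2$ and $$\tilde\Delta_B=\frac{c}{3\bar N_L}\ln\frac{L+1}{\epsilon_{\rm pB}}+\sqrt{\Big(\frac{c}{3\bar N_L}\ln\frac{L+1}{\epsilon_{\rm pB}}\Big)^2+\frac{2V}{\bar N_L}\ln\frac{L+1}{\epsilon_{\rm pB}}}.$$ If $E^U\ge 0$ or $L+1$ divides $N$, then $$\Pr[M_W\ge M_W^U]\le\epsilon_{\rm pB},\qquad M_W^U=(L+1)\bar N_L\,(E^U+\tilde\Delta_B).$$ If $E^U<0$, then $$\Pr\big[M_W\ge N E^U+(L+1)\bar N_L\tilde\Delta_B\big]\le\epsilon_{\rm pB}.$$ -/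

import Mathlib

open scoped TensorProduct CStarAlgebra ComplexConjugate InnerProductSpace ComplexOrder

noncomputable section

universe u v

namespace VEP

/-! ### Tensor powers of a Hilbert space -/

/-- A bundled complex Hilbert space. -/
structure HilbertSpace where
  carrier : Type u
  [normed : NormedAddCommGroup carrier]
  [inner : InnerProductSpace ℂ carrier]
  [complete : CompleteSpace carrier]

attribute [instance] HilbertSpace.normed HilbertSpace.inner HilbertSpace.complete

instance : CoeSort HilbertSpace (Type u) := ⟨HilbertSpace.carrier⟩

/-- The `n`-fold Hilbert space tensor power `H ⊗ (H ⊗ (⋯ ⊗ ℂ))`; every tensor product is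
completed. -/
def tensorPower (H : Type u) [NormedAddCommGroup H] [InnerProductSpace ℂ H] :
    ℕ → HilbertSpace.{u}
  | 0 => ⟨EuclideanSpace ℂ PUnit.{u + 1}⟩
  | n + 1 => ⟨UniformSpace.Completion (H ⊗[ℂ] (tensorPower H n))⟩

/-- The product vector `x₀ ⊗ x₁ ⊗ ⋯ ⊗ xₙ₋₁`. -/
def productVector {H : Type u} [NormedAddCommGroup H] [InnerProductSpace ℂ H] :
    (n : ℕ) → (Fin n → H) → tensorPower H n
  | 0, _ => (EuclideanSpace.single PUnit.unit 1 : EuclideanSpace ℂ PUnit.{u + 1})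
  | n + 1, x =>
    ((x 0 ⊗ₜ[ℂ] productVector n (Fin.tail x) : H ⊗[ℂ] (tensorPower H n)) :
      UniformSpace.Completion (H ⊗[ℂ] (tensorPower H n)))

/-- The product operator `X₀ ⊗ X₁ ⊗ ⋯ ⊗ Xₙ₋₁`. -/
def productOperator {H : Type u} [NormedAddCommGroup H] [InnerProductSpace ℂ H] :
    (n : ℕ) → (Fin n → (H →L[ℂ] H)) → (tensorPower H n →L[ℂ] tensorPower H n)
  | 0, _ => ContinuousLinearMap.id ℂ _
  | n + 1, X => (TensorProduct.mapL (X 0) (productOperator n (Fin.tail X))).completion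

/-! ### Alice's source -/

/-- An `L`-correlated source over `N` rounds with `nA` settings.  A setting sequence is a function
`i : Fin N → Fin nA` (rounds are numbered from `0`). -/
structure CorrelatedSource (nA N L : ℕ) (H : Type u) [NormedAddCommGroup H]
    [InnerProductSpace ℂ H] where
  /-- setting probabilities -/
  p : Fin nA → ℝ
  p_nonneg : ∀ i, 0 ≤ p i
  p_sum : ∑ i, p i = 1
  /-- reference states -/
  φ : Fin nA → H
  φ_norm : ∀ i, ‖φ i‖ = 1
  /-- the unknown orthogonal component of the state emitted in round `u` -/
  φperp : Fin N → (Fin N → Fin nA) → H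
  φperp_norm : ∀ u i, ‖φperp u i‖ = 1
  φperp_orthogonal : ∀ u i, ⟪φperp u i, φ (i u)⟫_ℂ = 0
  /-- `φperp u i` depends only on the settings of the rounds `u - L, …, u` (truncated to the rounds
  that exist) -/
  φperp_window : ∀ (u : Fin N) (i i' : Fin N → Fin nA), (∀ v : Fin N, (u : ℕ) ≤ v + L → v ≤ u → i v = i' v) →
    φperp u i = φperp u i'

namespace CorrelatedSource

variable {nA N L : ℕ} {H : Type u} [NormedAddCommGroup H] [InnerProductSpace ℂ H]

/-- The state `√(1-ε) |φ_{i_u}⟩ + √ε |φ^⊥⟩` emitted in round `u` for the setting sequence `i`. -/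
def emitted (src : CorrelatedSource nA N L H) (ε : ℝ) (u : Fin N) (i : Fin N → Fin nA) : H :=
  ((√(1 - ε) : ℝ) : ℂ) • src.φ (i u) + ((√ε : ℝ) : ℂ) • src.φperp u i

/-- The global state `∑_i ⨂_u √p_{i_u} |i_u⟩_{A_u} |ψ_u⟩_{C_u}`, given by its components
along the computational basis vectors `⨂_u |i_u⟩` of Alice's ancillas `A_1 ⋯ A_N`. -/
def globalState (src : CorrelatedSource nA N L H) (ε : ℝ) :
    PiLp 2 (fun _ : Fin N → Fin nA => (tensorPower H N : Type u)) :=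
  WithLp.toLp 2 fun i =>
    ((∏ u, √(src.p (i u)) : ℝ) : ℂ) • productVector N (fun u => src.emitted ε u i)

end CorrelatedSource

/-! ### Bob's measurements -/

/-- Bob's device.  The bases are `0` (the key basis `Z`) and `1, …, nM` (the test bases); an outcome
is `some 0`, `some 1` or `none` (no detection). -/
structure BobDevice (nM : ℕ) (H : Type v) [NormedAddCommGroup H] [InnerProductSpace ℂ H]
    [CompleteSpace H] where
  /-- basis probabilities -/
  pB : Fin (nM + 1) → ℝ
  pB_nonneg : ∀ β, 0 ≤ pB β
  pB_sum : ∑ β, pB β = 1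
  /-- the POVM of each basis -/
  Γ : Fin (nM + 1) → Option (Fin 2) → (H →L[ℂ] H)
  Γ_nonneg : ∀ β b, 0 ≤ Γ β b
  Γ_sum : ∀ β, ∑ b, Γ β b = 1
  /-- the virtual POVM -/
  ΓV : Option (Fin 2) → (H →L[ℂ] H)
  ΓV_nonneg : ∀ b, 0 ≤ ΓV b
  ΓV_sum : ∑ b, ΓV b = 1
  ΓV_none : ΓV none = Γ 0 none

/-! ### The round measurement of the virtual estimation protocol -/

/-- The set `𝒦` of triples `(i, β, b)` that belong to the sifted key: `β = Z` and
`i, b ∈ {0, 1}`. -/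
abbrev IsKey {nA nM : ℕ} (t : Fin nA × Fin (nM + 1) × Option (Fin 2)) : Prop :=
  (t.1 : ℕ) < 2 ∧ t.2.1 = 0 ∧ t.2.2 ≠ none

/-- Outcomes of one round: a virtual key outcome `(i, b)`, a test outcome `(i, β, b) ∉ 𝒦`, or a local
`W`-measurement outcome, labelled by an eigenvector of `W`. -/
abbrev Outcome (nA nM : ℕ) : Type :=
  (Fin 2 × Fin 2) ⊕
    ({t : Fin nA × Fin (nM + 1) × Option (Fin 2) // ¬ IsKey t} ⊕ Fin nA)

/-- The rank-one matrix `|x⟩⟨x|`. -/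
def ketbra {nA : ℕ} (x : EuclideanSpace ℂ (Fin nA)) : Matrix (Fin nA) (Fin nA) ℂ :=
  Matrix.of fun i j => x i * conj (x j)

/-- The Hadamard states `(|0⟩ ± |1⟩)/√2` in the span of the settings `0` and `1`. -/
def hadamard {nA : ℕ} (hnA : 2 ≤ nA) (i : Fin 2) : EuclideanSpace ℂ (Fin nA) :=
  (((√2)⁻¹ : ℝ) : ℂ) • (EuclideanSpace.single (Fin.castLE hnA 0) 1 +
    EuclideanSpace.single (Fin.castLE hnA 1) ((-1) ^ (i : ℕ)))

section Measurement

variable {nA nM : ℕ} {HB : Type v} [NormedAddCommGroup HB] [InnerProductSpace ℂ HB]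
  [CompleteSpace HB]

/-! Every POVM element of a round is a product
`outcomeWeight • (aliceOperator ⊗ bobOperator)`; namely
`(1-α) p_Z |i_X⟩⟨i_X| ⊗ Γ^{b|V}`, `(1-α) p_β |i⟩⟨i| ⊗ Γ^{b|β}` and `α |ω⟩⟨ω| ⊗ 1`. -/

def outcomeWeight (bob : BobDevice nM HB) (α : ℝ) : Outcome nA nM → ℝ
  | .inl _ => (1 - α) * bob.pB 0
  | .inr (.inl t) => (1 - α) * bob.pB t.1.2.1
  | .inr (.inr _) => α

def aliceOperator (hnA : 2 ≤ nA) (w : Fin nA → EuclideanSpace ℂ (Fin nA)) :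
    Outcome nA nM → Matrix (Fin nA) (Fin nA) ℂ
  | .inl (i, _) => ketbra (hadamard hnA i)
  | .inr (.inl t) => ketbra (EuclideanSpace.single t.1.1 1)
  | .inr (.inr k) => ketbra (w k)

def bobOperator (bob : BobDevice nM HB) : Outcome nA nM → (HB →L[ℂ] HB)
  | .inl (_, b) => bob.ΓV (some b)
  | .inr (.inl t) => bob.Γ t.1.2.1 t.1.2.2
  | .inr (.inr _) => 1

/-- The random variable `χ_W` of one round. -/
def chiW (ω : Fin nA → ℝ) : Outcome nA nM → ℝ
  | .inl _ => 0
  | .inr (.inl _) => 0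
  | .inr (.inr k) => ω k

/-- The random variable `M_W`, a function of the outcomes of all rounds. -/
def MW {N : ℕ} (ω : Fin nA → ℝ) (o : Fin N → Outcome nA nM) : ℝ :=
  ∑ u, chiW ω (o u)

end Measurement

/-! ### The law of the protocol -/

/-- A general quantum channel from `C_1 ⋯ C_N` to `B_1 ⋯ B_N`, in the Heisenberg picture: a unital
completely positive map from the observables of the output to those of the input. -/
structure Channel (HC : Type u) (HB : Type v) (N : ℕ)
    [NormedAddCommGroup HC] [InnerProductSpace ℂ HC]
    [NormedAddCommGroup HB] [InnerProductSpace ℂ HB] where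
  dual : (tensorPower HB N →L[ℂ] tensorPower HB N) →CP
    (tensorPower HC N →L[ℂ] tensorPower HC N)
  dual_one : dual 1 = 1

section Law

variable {nA nM N L : ℕ} {HC : Type u} {HB : Type v}
  [NormedAddCommGroup HC] [InnerProductSpace ℂ HC]
  [NormedAddCommGroup HB] [InnerProductSpace ℂ HB] [CompleteSpace HB]

/-- Born's rule: the probability of the outcome sequence `o`, that is
`⟨Ψ| ⨂_u a_{o_u} ⊗ 𝒞†(⨂_u b_{o_u}) |Ψ⟩ ∏_u weight(o_u)`, written out in the computational basis of
Alice's ancillas. -/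
def outcomeProb (hnA : 2 ≤ nA) (src : CorrelatedSource nA N L HC) (ε : ℝ)
    (bob : BobDevice nM HB) (𝒞 : Channel HC HB N) (α : ℝ)
    (w : Fin nA → EuclideanSpace ℂ (Fin nA)) (o : Fin N → Outcome nA nM) : ℝ :=
  (∏ u, outcomeWeight bob α (o u)) *
    (∑ i : Fin N → Fin nA, ∑ j : Fin N → Fin nA,
      (∏ u, aliceOperator hnA w (o u) (i u) (j u)) *
        ⟪src.globalState ε i,
          𝒞.dual (productOperator N fun u => bobOperator bob (o u)) (src.globalState ε j)⟫_ℂ).re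

open Classical in
/-- The probability of an event, a set of outcome sequences. -/
def prob (hnA : 2 ≤ nA) (src : CorrelatedSource nA N L HC) (ε : ℝ)
    (bob : BobDevice nM HB) (𝒞 : Channel HC HB N) (α : ℝ)
    (w : Fin nA → EuclideanSpace ℂ (Fin nA)) (S : Set (Fin N → Outcome nA nM)) : ℝ :=
  ∑ o with o ∈ S, outcomeProb hnA src ε bob 𝒞 α w o

end Law

/-! ### The semidefinite programs -/

/-- The feasible set `𝒮_const` of Gram matrices with blocks `G_φ`, `G_c`, `G_c†`, `G_⊥`. -/
def feasible {nA : ℕ} {H : Type u} [NormedAddCommGroup H] [InnerProductSpace ℂ H]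
    (φ : Fin nA → H) : Set (Matrix (Fin nA ⊕ Fin nA) (Fin nA ⊕ Fin nA) ℂ) :=
  {G | G.PosSemidef ∧ (∀ i j, G.toBlocks₁₁ i j = ⟪φ i, φ j⟫_ℂ) ∧
    (∀ i, G.toBlocks₁₂ i i = 0) ∧ (∀ i, G.toBlocks₂₂ i i = 1)}

/-- The matrix `ρ_A` as a function of `G`, with parameter `ε'`. -/
def rhoA {nA : ℕ} (p : Fin nA → ℝ) (ε' : ℝ)
    (G : Matrix (Fin nA ⊕ Fin nA) (Fin nA ⊕ Fin nA) ℂ) : Matrix (Fin nA) (Fin nA) ℂ :=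
  Matrix.of fun i j => ((√(p i * p j) : ℝ) : ℂ) *
    (((1 - ε' : ℝ) : ℂ) * G.toBlocks₁₁ j i + (ε' : ℂ) * G.toBlocks₂₂ j i +
      ((√((1 - ε') * ε') : ℝ) : ℂ) * (conj (G.toBlocks₁₂ i j) + G.toBlocks₁₂ j i))

/-- The effective parameter `ε' = 1 - (1 - ε)^(L+1)`. -/
def effectiveEps (ε : ℝ) (L : ℕ) : ℝ := 1 - (1 - ε) ^ (L + 1)

/-! ### The bound -/

/-- The values that `χ_W` can take: `0` and the eigenvalues of `W`. -/
def chiValues {nA : ℕ} (ω : Fin nA → ℝ) : Finset ℝ := insert 0 (Finset.univ.image ω)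

def omegaMin {nA : ℕ} (ω : Fin nA → ℝ) : ℝ := (chiValues ω).min' (Finset.insert_nonempty _ _)

def omegaMax {nA : ℕ} (ω : Fin nA → ℝ) : ℝ := (chiValues ω).max' (Finset.insert_nonempty _ _)

/-- `N̄_L = ⌈N / (L + 1)⌉`. -/
def Nbar (N L : ℕ) : ℕ := ⌈(N : ℝ) / ((L : ℝ) + 1)⌉₊

def cBound {nA : ℕ} (ω : Fin nA → ℝ) (EL EU : ℝ) : ℝ := max (omegaMax ω - EL) (EU - omegaMin ω)

def vBound (EL EU E2U : ℝ) : ℝ := E2U - (max 0 EL + min 0 EU) ^ 2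

/-- The deviation term `Δ̃_B`. -/
def deltaB {nA : ℕ} (N L : ℕ) (ω : Fin nA → ℝ) (EL EU E2U εpB : ℝ) : ℝ :=
  cBound ω EL EU / (3 * Nbar N L) * Real.log ((L + 1) / εpB) +
    √((cBound ω EL EU / (3 * Nbar N L) * Real.log ((L + 1) / εpB)) ^ 2 +
      2 * (vBound EL EU E2U / Nbar N L) * Real.log ((L + 1) / εpB))

/-- The bound `M_W^U = (L + 1) N̄_L (E^U + Δ̃_B)`. -/
def MWU {nA : ℕ} (N L : ℕ) (ω : Fin nA → ℝ) (EL EU E2U εpB : ℝ) : ℝ :=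
  ((L : ℝ) + 1) * Nbar N L * (EU + deltaB N L ω EL EU E2U εpB)

end VEP

end

noncomputable section

universe u v

namespace VEP

/-! ### Product vectors and product operators on tensor powers. -/

section TensorPower

variable {H : Type u} [NormedAddCommGroup H] [InnerProductSpace ℂ H]

/-! Only Alice's local measurement of `W` matters. The elements of all outcomes that do not report
an eigenvector add up to `(1 - α) • 1`, since the virtual key outcomes have the same sum as the
sifted outcomes they replace (`sum_unlabelled`). After merging outcomes that `M_W` does not
distinguish, Bob's operators are all `1`, the unital channel drops out of Born's rule, and the law
of `M_W` depends only on the overlaps of Alice's emitted states (`prob_eq_sum_localProb`,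
`bornFunctional_smul_one`).

Correlations are handled by splitting the rounds into the `L + 1` residue classes modulo `L + 1`.
Summing out the results outside a class makes the settings there a classical mixture. Given these
settings, the setting of a round `u` in the class influences only the rounds `u, …, u + L`, and
these blocks are disjoint for different `u`. So the overlaps factorize (`prod_inner_emitted`,
`sum_sum_factorize`) and the results within the class are conditionally independent. A block of `L +
1` emitted states overlaps by `√(1-ε)^(L+1) = √(1-ε')` with a product of reference states, and those
products have the Gram matrix of the `φ`'s. Hence each conditional round law is given by a feasible
point of the semidefinite programs (`exists_feasible_block`, `exists_outcome_law`), which bound its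
mean and second moment.

Bernstein's estimate then bounds the moment generating function of each class
(`mgf_residueClass_le`). If `M_W` exceeds the threshold, some class exceeds its share; Markov's
inequality gives each class probability `εpB / (L + 1)`, and the union over the classes costs the
factor `L + 1` (`prob_le_of_threshold`). -/

theorem inner_productVector (n : ℕ) (x y : Fin n → H) :
    ⟪productVector n x, productVector n y⟫_ℂ = ∏ u, ⟪x u, y u⟫_ℂ := by
  induction n with
  | zero =>
    change ⟪(EuclideanSpace.single PUnit.unit 1 : EuclideanSpace ℂ PUnit.{u + 1}),
      EuclideanSpace.single PUnit.unit 1⟫_ℂ = _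
    simp
  | succ n ih =>
    rw [Fin.prod_univ_succ]
    refine (UniformSpace.Completion.inner_coe (𝕜 := ℂ) _ _).trans ?_
    rw [TensorProduct.inner_tmul, ih]
    rfl

theorem completion_add {E F : Type*} [NormedAddCommGroup E] [NormedSpace ℂ E]
    [NormedAddCommGroup F] [NormedSpace ℂ F] (f g : E →L[ℂ] F) :
    (f + g).completion = f.completion + g.completion := by
  ext x
  induction x using UniformSpace.Completion.induction_on with
  | hp => exact isClosed_eq (ContinuousLinearMap.continuous _) (ContinuousLinearMap.continuous _)
  | ih a => simp [UniformSpace.Completion.coe_add]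

theorem completion_smul {E F : Type*} [NormedAddCommGroup E] [NormedSpace ℂ E]
    [NormedAddCommGroup F] [NormedSpace ℂ F] (c : ℂ) (f : E →L[ℂ] F) :
    (c • f).completion = c • f.completion := by
  ext x
  induction x using UniformSpace.Completion.induction_on with
  | hp => exact isClosed_eq (ContinuousLinearMap.continuous _) (ContinuousLinearMap.continuous _)
  | ih a =>
    simp only [ContinuousLinearMap.completion_apply_coe, _root_.smul_apply]
    exact UniformSpace.Completion.coe_smul c (f a)

theorem completion_id {E : Type*} [NormedAddCommGroup E] [NormedSpace ℂ E] :
    (ContinuousLinearMap.id ℂ E).completion = ContinuousLinearMap.id ℂ _ := by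
  ext x
  induction x using UniformSpace.Completion.induction_on with
  | hp => exact isClosed_eq (ContinuousLinearMap.continuous _) (ContinuousLinearMap.continuous _)
  | ih a => simp

theorem productOperator_update_add (n : ℕ) (X : Fin n → (H →L[ℂ] H)) (u : Fin n)
    (x y : H →L[ℂ] H) :
    productOperator n (Function.update X u (x + y)) =
      productOperator n (Function.update X u x) + productOperator n (Function.update X u y) := by
  induction n with
  | zero => exact u.elim0
  | succ n ih =>
    refine Fin.cases ?_ (fun u => ?_) u
    · simp only [productOperator, Fin.tail_update_zero, Function.update_self,
        TensorProduct.mapL_add_left]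
      exact completion_add _ _
    · simp only [productOperator, Fin.tail_update_succ, ih,
        Function.update_of_ne (Fin.succ_ne_zero u).symm, TensorProduct.mapL_add_right]
      exact completion_add _ _

theorem productOperator_update_smul (n : ℕ) (X : Fin n → (H →L[ℂ] H)) (u : Fin n)
    (c : ℂ) (x : H →L[ℂ] H) :
    productOperator n (Function.update X u (c • x)) =
      c • productOperator n (Function.update X u x) := by
  induction n with
  | zero => exact u.elim0
  | succ n ih =>
    refine Fin.cases ?_ (fun u => ?_) u
    · simp only [productOperator, Fin.tail_update_zero, Function.update_self,
        TensorProduct.mapL_smul_left]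
      exact completion_smul _ _
    · simp only [productOperator, Fin.tail_update_succ, ih,
        Function.update_of_ne (Fin.succ_ne_zero u).symm, TensorProduct.mapL_smul_right]
      exact completion_smul _ _

/-- The product operator as a multilinear map of its factors. -/
def productOperatorMultilinear (n : ℕ) :
    MultilinearMap ℂ (fun _ : Fin n => H →L[ℂ] H) (tensorPower H n →L[ℂ] tensorPower H n) where
  toFun := productOperator n
  map_update_add' X u x y := by
    convert productOperator_update_add n X u x y
  map_update_smul' X u c x := by
    convert productOperator_update_smul n X u c x

/-- Together with unitality of the dual channel, this makes the channel disappear once Bob's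
operators are summed to the identity. -/
theorem productOperator_one (n : ℕ) :
    productOperator n (fun _ => (1 : H →L[ℂ] H)) = 1 := by
  induction n with
  | zero => rfl
  | succ n ih =>
    have ht : Fin.tail (fun _ : Fin (n + 1) => (1 : H →L[ℂ] H)) = fun _ => 1 := rfl
    simp only [productOperator, ht, ih]
    refine (congrArg ContinuousLinearMap.completion TensorProduct.mapL_id_id).trans ?_
    exact completion_id

end TensorPower

/-! ### Bernstein's inequality for one round, and the choice of its parameter. -/

section Bernstein

/-- The difference of the two sides vanishes at `0` and has derivative `1 + y - e^y ≤ 0`. -/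
theorem exp_le_quadratic_of_nonpos {y : ℝ} (hy : y ≤ 0) : Real.exp y ≤ 1 + y + y ^ 2 / 2 := by
  have hF : AntitoneOn (fun y : ℝ => 1 + y + y ^ 2 / 2 - Real.exp y) (Set.Iic 0) := by
    apply antitoneOn_of_deriv_nonpos (convex_Iic 0) (by fun_prop) (by fun_prop)
    intro x _
    have hd : HasDerivAt (fun y : ℝ => 1 + y + y ^ 2 / 2 - Real.exp y)
        (1 + (2 : ℕ) * x ^ (2 - 1) / 2 - Real.exp x) x :=
      (((hasDerivAt_id x).const_add 1).add ((hasDerivAt_pow 2 x).div_const 2)).sub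
        (Real.hasDerivAt_exp x)
    rw [hd.deriv]
    norm_num
    linarith [Real.add_one_le_exp x]
  have := hF (Set.mem_Iic.2 hy) (Set.mem_Iic.2 le_rfl) hy
  simp only [Real.exp_zero] at this
  norm_num at this
  linarith

/-- The key inequality `(1 - y/3)(e^y - 1 - y) ≤ y²/2` for `y ≥ 0`. -/
theorem one_sub_mul_exp_sub_le {y : ℝ} (hy : 0 ≤ y) :
    (1 - y / 3) * (Real.exp y - 1 - y) ≤ y ^ 2 / 2 := by
  -- This function is three times the derivative of the difference of the two sides. It vanishes at
  -- `0`, and its own derivative `1 + (y - 1) e^y` is nonnegative because `1 - y ≤ e^(-y)`.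
  have hG : MonotoneOn (fun y : ℝ => 2 * y + (y - 2) * (Real.exp y - 1)) (Set.Ici 0) := by
    apply monotoneOn_of_deriv_nonneg (convex_Ici 0) (by fun_prop) (by fun_prop)
    intro x hx
    have hd : HasDerivAt (fun y : ℝ => 2 * y + (y - 2) * (Real.exp y - 1))
        (2 * 1 + (1 * (Real.exp x - 1) + (x - 2) * Real.exp x)) x :=
      ((hasDerivAt_id x).const_mul 2).add
        (((hasDerivAt_id x).sub_const 2).mul ((Real.hasDerivAt_exp x).sub_const 1))
    rw [hd.deriv]
    have h1 := Real.add_one_le_exp (-x)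
    have h2 : Real.exp (-x) * Real.exp x = 1 := by rw [← Real.exp_add]; simp
    nlinarith [Real.exp_pos x, mul_le_mul_of_nonneg_right h1 (Real.exp_pos x).le]
  have hG0 : ∀ x : ℝ, 0 ≤ x → 0 ≤ 2 * x + (x - 2) * (Real.exp x - 1) := by
    intro x hx
    have := hG (Set.mem_Ici.2 le_rfl) (Set.mem_Ici.2 hx) hx
    simpa using this
  have hF : MonotoneOn (fun y : ℝ => y ^ 2 / 2 - (1 - y / 3) * (Real.exp y - 1 - y))
      (Set.Ici 0) := by
    apply monotoneOn_of_deriv_nonneg (convex_Ici 0) (by fun_prop) (by fun_prop)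
    intro x hx
    have hd : HasDerivAt (fun y : ℝ => y ^ 2 / 2 - (1 - y / 3) * (Real.exp y - 1 - y))
        ((2 : ℕ) * x ^ (2 - 1) / 2 - ((-(1 / 3)) * (Real.exp x - 1 - x) +
          (1 - x / 3) * (Real.exp x - 1))) x :=
      ((hasDerivAt_pow 2 x).div_const 2).sub
        ((((hasDerivAt_id x).div_const 3).const_sub 1).mul
          (((Real.hasDerivAt_exp x).sub_const 1).sub (hasDerivAt_id x)))
    rw [hd.deriv]
    rw [interior_Ici] at hx
    have := hG0 x (le_of_lt hx)
    norm_num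
    nlinarith
  have := hF (Set.mem_Ici.2 le_rfl) (Set.mem_Ici.2 hy) hy
  simp only [Real.exp_zero] at this
  norm_num at this
  linarith

/-- The point is that `y` needs only an upper bound: for `y ≤ 0` the quadratic estimate is already
stronger, and for `y ≥ 0` one may replace `1 - y/3` by the smaller `1 - x/3`. -/
theorem exp_le_bernstein {x y : ℝ} (hx0 : 0 ≤ x) (hx3 : x < 3) (hyx : y ≤ x) :
    Real.exp y ≤ 1 + y + y ^ 2 / (2 * (1 - x / 3)) := by
  have hx : 0 < 1 - x / 3 := by linarith
  rcases le_total y 0 with hy | hy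
  · have h := exp_le_quadratic_of_nonpos hy
    have : y ^ 2 / 2 ≤ y ^ 2 / (2 * (1 - x / 3)) := by
      apply div_le_div_of_nonneg_left (sq_nonneg y) (by linarith) (by linarith)
    linarith
  · have h := one_sub_mul_exp_sub_le hy
    have h0 : 0 ≤ Real.exp y - 1 - y := by linarith [Real.add_one_le_exp y]
    have h2 : (1 - x / 3) * (Real.exp y - 1 - y) ≤ y ^ 2 / 2 :=
      (mul_le_mul_of_nonneg_right (by linarith) h0).trans h
    have h3 : Real.exp y - 1 - y ≤ y ^ 2 / (2 * (1 - x / 3)) := by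
      rw [le_div_iff₀ (by linarith)]
      nlinarith
    linarith

/-- Bernstein's bound for the moment generating function of a random variable with finitely many
values `χ o`, taken with probabilities `P o`. -/
theorem mgf_le {O : Type*} [Fintype O] (P χ : O → ℝ) (hP : ∀ o, 0 ≤ P o) (hP1 : ∑ o, P o = 1)
    {EL EU c V t : ℝ} (hEL : EL ≤ ∑ o, P o * χ o) (hEU : ∑ o, P o * χ o ≤ EU)
    (hV : ∑ o, P o * χ o ^ 2 - (∑ o, P o * χ o) ^ 2 ≤ V) (hc : ∀ o, χ o - EL ≤ c)
    (hc0 : 0 ≤ c) (ht : 0 ≤ t) (htc : t * c < 3) :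
    ∑ o, P o * Real.exp (t * χ o) ≤
      Real.exp (t * EU + V * (t ^ 2 / (2 * (1 - t * c / 3)))) := by
  set μ := ∑ o, P o * χ o with hμ
  set g := t ^ 2 / (2 * (1 - t * c / 3)) with hg
  have hg0 : 0 ≤ g := by
    have : 0 < 1 - t * c / 3 := by linarith
    positivity
  -- The estimate is applied to the centred variable, which is at most `c` because `EL ≤ μ`. Its
  -- linear term vanishes on averaging.
  have h1 : ∀ o, P o * Real.exp (t * χ o) ≤
      Real.exp (t * μ) * (P o * (1 + t * (χ o - μ) + (χ o - μ) ^ 2 * g)) := by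
    intro o
    have hy : t * (χ o - μ) ≤ t * c :=
      mul_le_mul_of_nonneg_left (by linarith [hc o]) ht
    have h := exp_le_bernstein (mul_nonneg ht hc0) htc hy
    have e1 : Real.exp (t * χ o) = Real.exp (t * μ) * Real.exp (t * (χ o - μ)) := by
      rw [← Real.exp_add]; ring_nf
    have e2 : (t * (χ o - μ)) ^ 2 / (2 * (1 - t * c / 3)) = (χ o - μ) ^ 2 * g := by
      rw [hg]; ring
    rw [e2] at h
    rw [e1, mul_left_comm]
    exact mul_le_mul_of_nonneg_left (mul_le_mul_of_nonneg_left h (hP o)) (Real.exp_pos _).le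
  have h2 : ∑ o, P o * (1 + t * (χ o - μ) + (χ o - μ) ^ 2 * g) =
      1 + (∑ o, P o * χ o ^ 2 - μ ^ 2) * g := by
    have : ∀ o, P o * (1 + t * (χ o - μ) + (χ o - μ) ^ 2 * g) =
        (1 - t * μ + μ ^ 2 * g) * P o + (t - 2 * μ * g) * (P o * χ o) +
          g * (P o * χ o ^ 2) := fun o => by ring
    simp only [this, Finset.sum_add_distrib, ← Finset.mul_sum, hP1, ← hμ]
    ring
  calc ∑ o, P o * Real.exp (t * χ o)
      ≤ Real.exp (t * μ) * (1 + (∑ o, P o * χ o ^ 2 - μ ^ 2) * g) := by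
        rw [← h2, Finset.mul_sum]
        exact Finset.sum_le_sum fun o _ => h1 o
    _ ≤ Real.exp (t * μ) * Real.exp (V * g) := by
        refine mul_le_mul_of_nonneg_left ?_ (Real.exp_pos _).le
        have := Real.add_one_le_exp (V * g)
        have := mul_le_mul_of_nonneg_right hV hg0
        linarith
    _ ≤ Real.exp (t * EU + V * g) := by
        rw [← Real.exp_add]
        exact Real.exp_le_exp.2 (by linarith [mul_le_mul_of_nonneg_left hEU ht])

/-- For the deviation `Δ` that solves Bernstein's quadratic equation, some parameter `t` of the
moment generating function attains the exponent `-ℓ`. -/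
theorem exists_bernstein_parameter {c V ℓ n Δ : ℝ} (hc : 0 < c) (hV : 0 ≤ V) (hℓ : 0 < ℓ)
    (hn : 0 < n)
    (hΔ : Δ = c / (3 * n) * ℓ + √((c / (3 * n) * ℓ) ^ 2 + 2 * (V / n) * ℓ)) :
    ∃ t, 0 ≤ t ∧ t * c < 3 ∧ n * (V * (t ^ 2 / (2 * (1 - t * c / 3))) - t * Δ) ≤ -ℓ := by
  have ha : 0 < c / (3 * n) * ℓ := by positivity
  set a := c / (3 * n) * ℓ with haa
  have hs := Real.sq_sqrt (show 0 ≤ a ^ 2 + 2 * (V / n) * ℓ by positivity)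
  have hsa : a ≤ √(a ^ 2 + 2 * (V / n) * ℓ) := by
    apply Real.le_sqrt_of_sq_le
    have : 0 ≤ 2 * (V / n) * ℓ := by positivity
    linarith
  have hΔ2 : 2 * a ≤ Δ := by rw [hΔ]; linarith
  have hΔ0 : 0 < Δ := by linarith
  have hq : Δ ^ 2 = 2 * a * Δ + 2 * (V / n) * ℓ := by
    have : √(a ^ 2 + 2 * (V / n) * ℓ) = Δ - a := by rw [hΔ]; ring
    rw [this] at hs
    nlinarith
  have hna : n * a = c * ℓ / 3 := by rw [haa]; field_simp
  -- The quadratic equation in Bernstein's form: the exponent `n Δ² / (2 (V + c Δ / 3))` equals `ℓ`.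
  have hq' : n * Δ ^ 2 = 2 * (V + c * Δ / 3) * ℓ := by
    have h1 : n * Δ ^ 2 = 2 * (n * a) * Δ + 2 * (n * (V / n)) * ℓ := by rw [hq]; ring
    rw [h1, hna, mul_div_cancel₀ _ hn.ne']; ring
  rcases hV.eq_or_lt with hV0 | hV0
  -- For `V = 0` the usual choice below would be `t = 3 / c`, which `t * c < 3` excludes. With `2 /
  -- c` the exponent is at most `-4ℓ/3`, which leaves room.
  · refine ⟨2 / c, by positivity, by rw [div_mul_cancel₀ _ hc.ne']; norm_num, ?_⟩
    rw [← hV0, zero_mul, zero_sub]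
    have h1 : n * Δ * (2 / c) ≥ n * (2 * a) * (2 / c) := by gcongr
    have h2 : n * (2 * a) * (2 / c) = 4 / 3 * ℓ := by
      rw [show n * (2 * a) = 2 * (n * a) by ring, hna]; field_simp; norm_num
    nlinarith
  · have hD : 0 < V + c * Δ / 3 := by positivity
    refine ⟨Δ / (V + c * Δ / 3), by positivity, ?_, ?_⟩
    · rw [div_mul_eq_mul_div, div_lt_iff₀ hD]; nlinarith
    · have h1 : 1 - Δ / (V + c * Δ / 3) * c / 3 = V / (V + c * Δ / 3) := by
        field_simp; ring
      rw [h1]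
      have h2 : n * (V * ((Δ / (V + c * Δ / 3)) ^ 2 / (2 * (V / (V + c * Δ / 3)))) -
          Δ / (V + c * Δ / 3) * Δ) = - (n * Δ ^ 2) / (2 * (V + c * Δ / 3)) := by
        field_simp; ring
      rw [h2, hq', neg_div, mul_div_cancel_left₀ _ (by positivity)]

end Bernstein

/-! ### Residue classes of rounds, and factorization of double sums. -/

section Combinatorics

/-- The rounds before `N` in the residue class `r` modulo `L + 1` start consecutive blocks of
length `L + 1`, which cover the rounds from `r` on. -/
theorem prod_range_eq_prod_blocks {M : Type*} [CommMonoid M] (F : ℕ → M) {N L r : ℕ}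
    (hr : r < L + 1) (hN : ∀ v, N ≤ v → F v = 1) (hlt : ∀ v, v < r → F v = 1) :
    ∏ v ∈ Finset.range N, F v =
      ∏ u ∈ (Finset.range N).filter (fun u => u % (L + 1) = r),
        ∏ m ∈ Finset.range (L + 1), F (u + m) := by
  -- A round `v ≥ r` lies in exactly one block, which starts at `r + (L + 1) * ((v - r) / (L + 1))`;
  -- for `v < r` the factor is `1` anyway.
  have h1 : ∀ v ∈ Finset.range N, F v =
      ∏ u ∈ (Finset.range N).filter (fun u => u % (L + 1) = r),
        if v ∈ Finset.Ico u (u + (L + 1)) then F v else 1 := by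
    intro v hv
    rw [Finset.mem_range] at hv
    rcases lt_or_ge v r with hvr | hvr
    · simp [hlt v hvr]
    · have hd := Nat.div_add_mod (v - r) (L + 1)
      have hml := Nat.mod_lt (v - r) (Nat.add_one_pos L)
      have hbase : r + (L + 1) * ((v - r) / (L + 1)) ≤ v := by omega
      rw [Finset.prod_eq_single (r + (L + 1) * ((v - r) / (L + 1)))]
      · rw [if_pos]
        rw [Finset.mem_Ico]
        omega
      · intro u hu hne
        rw [if_neg]
        intro hmem
        apply hne
        rw [Finset.mem_filter] at hu
        rw [Finset.mem_Ico] at hmem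
        have hu' := Nat.div_add_mod u (L + 1)
        have e : (v - r) / (L + 1) = u / (L + 1) := by
          rw [Nat.div_eq_iff (Nat.add_one_pos L)]
          have : u / (L + 1) * (L + 1) = (L + 1) * (u / (L + 1)) := mul_comm _ _
          omega
        rw [e]
        omega
      · intro hn
        exfalso
        apply hn
        rw [Finset.mem_filter, Finset.mem_range, Nat.add_mul_mod_self_left,
          Nat.mod_eq_of_lt hr]
        exact ⟨by omega, rfl⟩
  rw [Finset.prod_congr rfl h1, Finset.prod_comm]
  refine Finset.prod_congr rfl fun u _ => ?_
  rw [← Finset.prod_filter]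
  have h2 : ∏ m ∈ Finset.range (L + 1), F (u + m) = ∏ v ∈ Finset.Ico u (u + (L + 1)), F v := by
    rw [Finset.prod_Ico_eq_prod_range]; simp
  rw [h2]
  refine Finset.prod_subset (fun v hv => (Finset.mem_filter.1 hv).2) fun v hv hn => ?_
  apply hN
  by_contra hlt'
  exact hn (Finset.mem_filter.2 ⟨Finset.mem_range.2 (by omega), hv⟩)

theorem le_mul_Nbar (N L : ℕ) : N ≤ (L + 1) * Nbar N L := by
  have h := Nat.le_ceil ((N : ℝ) / ((L : ℝ) + 1))
  rw [div_le_iff₀ (by positivity)] at h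
  have : (N : ℝ) ≤ ((L + 1) * Nbar N L : ℕ) := by
    push_cast
    rw [mul_comm]
    exact h
  exact_mod_cast this

theorem mul_Nbar_of_dvd {N L : ℕ} (h : (L + 1) ∣ N) : (L + 1) * Nbar N L = N := by
  obtain ⟨k, rfl⟩ := h
  have : (((L + 1) * k : ℕ) : ℝ) / ((L : ℝ) + 1) = k := by
    push_cast
    field_simp
  rw [Nbar, this, Nat.ceil_natCast]

/-- The rounds that are congruent to `r` modulo `L + 1`. -/
def residueClass (N L r : ℕ) : Finset (Fin N) :=
  Finset.univ.filter fun u : Fin N => (u : ℕ) % (L + 1) = r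

/-- Within a class, a round is determined by its quotient by `L + 1`, and the quotients are below
`Nbar N L`. -/
theorem card_residueClass_le (N L r : ℕ) : (residueClass N L r).card ≤ Nbar N L := by
  rw [← Finset.card_range (Nbar N L)]
  refine Finset.card_le_card_of_injOn (fun u => (u : ℕ) / (L + 1)) ?_ ?_
  · intro u _
    have := le_mul_Nbar N L
    rw [Finset.coe_range, Set.mem_Iio, Nat.div_lt_iff_lt_mul (Nat.add_one_pos L), mul_comm]
    exact lt_of_lt_of_le u.2 this
  · intro u hu v hv huv
    have hu' := (Finset.mem_filter.1 hu).2
    have hv' := (Finset.mem_filter.1 hv).2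
    apply Fin.ext
    rw [← Nat.div_add_mod u (L + 1), ← Nat.div_add_mod v (L + 1), hu', hv']
    simp only at huv
    rw [huv]

theorem sum_residueClasses {N : ℕ} (L : ℕ) (f : Fin N → ℝ) :
    ∑ r ∈ Finset.range (L + 1), ∑ u ∈ residueClass N L r, f u = ∑ u, f u :=
  Finset.sum_fiberwise_of_maps_to
    (g := fun u : Fin N => (u : ℕ) % (L + 1))
    (fun u _ => Finset.mem_range.2 (Nat.mod_lt (u : ℕ) (Nat.add_one_pos L))) f

theorem prod_sum_sum {ι S R : Type*} [Fintype ι] [DecidableEq ι] [Fintype S] [CommSemiring R]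
    (f : ι → S → S → R) :
    ∏ u, ∑ a, ∑ b, f u a b = ∑ a : ι → S, ∑ b : ι → S, ∏ u, f u (a u) (b u) := by
  classical
  rw [Finset.prod_univ_sum, Fintype.piFinset_univ]
  refine Finset.sum_congr rfl fun a _ => ?_
  rw [Finset.prod_univ_sum, Fintype.piFinset_univ]

/-- A double sum over pairs of sequences factorizes if its weights are diagonal outside the set
`p` of indices and its kernel factorizes over `p`, for each choice of the entries outside. -/
theorem sum_sum_factorize {ι S R : Type*} [Fintype ι] [DecidableEq ι] [Fintype S] [DecidableEq S]
    [CommSemiring R] (p : ι → Prop) [DecidablePred p] (D : ι → S → S → R)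
    (K : (ι → S) → (ι → S) → R) (d : ι → S → R)
    (k : {u // p u} → ({u // ¬ p u} → S) → S → S → R)
    (hD : ∀ u, ¬ p u → ∀ a b, D u a b = if a = b then d u a else 0)
    (hK : ∀ a b s, K ((Equiv.piEquivPiSubtypeProd p fun _ => S).symm (a, s))
      ((Equiv.piEquivPiSubtypeProd p fun _ => S).symm (b, s)) = ∏ u, k u s (a u) (b u)) :
    ∑ i : ι → S, ∑ j : ι → S, (∏ u, D u (i u) (j u)) * K i j =
      ∑ s : {u // ¬ p u} → S, (∏ v : {u // ¬ p u}, d v (s v)) *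
        ∏ u : {u // p u}, ∑ a, ∑ b, D u a b * k u s a b := by
  set e := (Equiv.piEquivPiSubtypeProd p fun _ => S).symm with he
  have hpos : ∀ a s (u : {u // p u}), e (a, s) u = a u := by
    intro a s u
    simp [he, Equiv.piEquivPiSubtypeProd, u.2]
  have hneg : ∀ a s (u : {u // ¬ p u}), e (a, s) u = s u := by
    intro a s u
    simp [he, Equiv.piEquivPiSubtypeProd, u.2]
  -- Diagonality outside `p` forces both sequences to have the same outer entries, which leaves a
  -- single sum over `s`.
  have hprod : ∀ a s b s', ∏ u, D u (e (a, s) u) (e (b, s') u) =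
      (∏ u : {u // p u}, D u (a u) (b u)) * if s = s' then ∏ v : {u // ¬ p u}, d v (s v) else 0 := by
    intro a s b s'
    rw [← Fintype.prod_subtype_mul_prod_subtype p]
    congr 1
    · exact Finset.prod_congr rfl fun u _ => by rw [hpos, hpos]
    · rw [Finset.prod_congr rfl fun v _ => by rw [hneg, hneg, hD v v.2]]
      split_ifs with h
      · subst h
        simp
      · obtain ⟨v, hv⟩ := Function.ne_iff.1 h
        exact Finset.prod_eq_zero (Finset.mem_univ v) (if_neg hv)
  rw [← e.sum_comp, Fintype.sum_prod_type_right]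
  refine Finset.sum_congr rfl fun s _ => ?_
  rw [prod_sum_sum, Finset.mul_sum]
  refine Finset.sum_congr rfl fun a _ => ?_
  rw [← e.sum_comp, Fintype.sum_prod_type, Finset.mul_sum]
  refine Finset.sum_congr rfl fun b _ => ?_
  rw [Finset.sum_eq_single s]
  · rw [hprod, hK, if_pos rfl, Finset.prod_mul_distrib]
    ring
  · intro s' _ hne
    rw [hprod, if_neg hne.symm]
    simp
  · simp

end Combinatorics

/-! ### Feasible points from families of vectors. -/

section Feasible

variable {nA : ℕ}

/-- Decompose `Φ i = √(1-ε) R i + √ε P i` with `P i` a unit vector orthogonal to `R i`. The Gram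
matrix of the `R`'s and `P`'s is feasible, and expanding `⟪Φ j, Φ i⟫` gives the bracket in `rhoA`.
The vectors `Q` serve as `P` when `ε = 0`, where `Φ` does not determine `P`. -/
theorem exists_feasible_of_vectors {H E : Type*} [NormedAddCommGroup H] [InnerProductSpace ℂ H]
    [NormedAddCommGroup E] [InnerProductSpace ℂ E] {φ : Fin nA → H} {R Φ Q : Fin nA → E} {ε : ℝ}
    (hε0 : 0 ≤ ε) (hε1 : ε ≤ 1) (hR : ∀ i j, ⟪R i, R j⟫_ℂ = ⟪φ i, φ j⟫_ℂ)
    (hφ : ∀ i, ‖φ i‖ = 1) (hΦ : ∀ i, ⟪Φ i, Φ i⟫_ℂ = 1)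
    (hRΦ : ∀ i, ⟪R i, Φ i⟫_ℂ = ((√(1 - ε) : ℝ) : ℂ))
    (hQ : ∀ i, ⟪Q i, Q i⟫_ℂ = 1) (hRQ : ∀ i, ⟪R i, Q i⟫_ℂ = 0) :
    ∃ G ∈ feasible φ, ∀ (p : Fin nA → ℝ) i j,
      rhoA p ε G i j = ((√(p i * p j) : ℝ) : ℂ) * ⟪Φ j, Φ i⟫_ℂ := by
  have hRR : ∀ i, ⟪R i, R i⟫_ℂ = 1 := by
    intro i
    rw [hR, inner_self_eq_norm_sq_to_K, hφ]
    simp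
  have hΦR : ∀ i, ⟪Φ i, R i⟫_ℂ = ((√(1 - ε) : ℝ) : ℂ) := by
    intro i
    rw [← inner_conj_symm, hRΦ, Complex.conj_ofReal]
  set s : ℂ := ((√(1 - ε) : ℝ) : ℂ) with hs
  set e : ℂ := ((√ε : ℝ) : ℂ) with he
  have hs2 : s * s = ((1 - ε : ℝ) : ℂ) := by
    rw [hs, ← Complex.ofReal_mul, Real.mul_self_sqrt (by linarith)]
  have he2 : e * e = (ε : ℂ) := by
    rw [he, ← Complex.ofReal_mul, Real.mul_self_sqrt hε0]
  have hse : s * e = ((√((1 - ε) * ε) : ℝ) : ℂ) := by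
    rw [hs, he, ← Complex.ofReal_mul, Real.sqrt_mul (by linarith)]
  have hsc : conj s = s := Complex.conj_ofReal _
  have hec : conj e = e := Complex.conj_ofReal _
  have key : ∃ P : Fin nA → E, (∀ i, Φ i = s • R i + e • P i) ∧ (∀ i, ⟪P i, P i⟫_ℂ = 1) ∧
      ∀ i, ⟪R i, P i⟫_ℂ = 0 := by
    rcases hε0.eq_or_lt with h0 | h0
    · refine ⟨Q, fun i => ?_, hQ, hRQ⟩
      have he0 : e = 0 := by rw [he, ← h0]; simp
      have hs1 : s = 1 := by rw [hs, ← h0]; simp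
      -- For `ε = 0` the unit vectors `Φ i` and `R i` have overlap `1`, so their difference has norm
      -- zero.
      rw [he0, hs1, one_smul, zero_smul, add_zero, ← sub_eq_zero, ← inner_self_eq_zero (𝕜 := ℂ),
        inner_sub_left, inner_sub_right, inner_sub_right, hΦ, hΦR, hRΦ, hRR, hs1]
      ring
    · have he0 : e ≠ 0 := by
        rw [he, Complex.ofReal_ne_zero]
        exact (Real.sqrt_pos.2 h0).ne'
      have hei : conj e⁻¹ = e⁻¹ := by rw [map_inv₀, hec]
      refine ⟨fun i => e⁻¹ • (Φ i - s • R i), fun i => ?_, fun i => ?_, fun i => ?_⟩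
      · rw [smul_inv_smul₀ he0]
        abel
      · rw [inner_smul_left, inner_smul_right, inner_sub_left, inner_sub_right, inner_sub_right,
          inner_smul_left, inner_smul_right, inner_smul_left, inner_smul_right, hΦ, hΦR, hRΦ, hRR,
          hei, hsc]
        field_simp
        push_cast at hs2
        linear_combination (-1 : ℂ) * hs2 - he2
      · rw [inner_smul_right, inner_sub_right, inner_smul_right, hRΦ, hRR]
        simp
  obtain ⟨P, hΦP, hPP, hRP⟩ := key
  refine ⟨Matrix.gram ℂ (Sum.elim R P), ⟨Matrix.posSemidef_gram ℂ _, ?_, ?_, ?_⟩, ?_⟩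
  · intro i j
    exact hR i j
  · exact hRP
  · exact hPP
  · intro p i j
    simp only [rhoA, Matrix.of_apply, Matrix.toBlocks₁₁, Matrix.toBlocks₂₂, Matrix.toBlocks₁₂,
      Matrix.gram_apply, Sum.elim_inl, Sum.elim_inr, inner_conj_symm]
    rw [hΦP i, hΦP j]
    simp only [inner_add_left, inner_add_right, inner_smul_left, inner_smul_right, hsc, hec]
    rw [← hs2, ← he2, ← hse]
    ring

end Feasible

/-! ### Rank-one projectors and spectral sums. -/

section Ketbra

variable {nA : ℕ}

theorem sum_ketbra (w : OrthonormalBasis (Fin nA) ℂ (EuclideanSpace ℂ (Fin nA))) :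
    ∑ k, ketbra (w k) = 1 := by
  ext i j
  have h := congrArg (fun x : EuclideanSpace ℂ (Fin nA) => x i)
    (w.sum_repr' (EuclideanSpace.single j 1))
  simp only [EuclideanSpace.inner_single_right, one_mul] at h
  rw [WithLp.ofLp_sum, Finset.sum_apply] at h
  rw [Matrix.sum_apply, Matrix.one_apply]
  simp only [ketbra, Matrix.of_apply]
  rw [Finset.sum_congr rfl fun k _ => mul_comm (w k i) _]
  refine h.trans ?_
  simp

theorem ketbra_mul_ketbra (x y : EuclideanSpace ℂ (Fin nA)) :
    ketbra x * ketbra y = ⟪x, y⟫_ℂ • Matrix.of fun i j => x i * conj (y j) := by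
  ext i j
  simp only [ketbra, Matrix.mul_apply, Matrix.of_apply, Matrix.smul_apply, smul_eq_mul,
    PiLp.inner_apply, RCLike.inner_apply, Finset.sum_mul]
  refine Finset.sum_congr rfl fun l _ => ?_
  ring

/-- This turns the bound on `W ^ 2` into a bound on the second moment of the reported eigenvalue. -/
theorem sq_sum_smul_ketbra (ω : Fin nA → ℝ)
    (w : OrthonormalBasis (Fin nA) ℂ (EuclideanSpace ℂ (Fin nA))) :
    (∑ k, (ω k : ℂ) • ketbra (w k)) ^ 2 = ∑ k, ((ω k ^ 2 : ℝ) : ℂ) • ketbra (w k) := by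
  rw [sq, Finset.sum_mul_sum]
  refine Finset.sum_congr rfl fun k _ => ?_
  rw [Finset.sum_eq_single k]
  · rw [smul_mul_smul_comm, ketbra_mul_ketbra, inner_self_eq_norm_sq_to_K, w.orthonormal.1 k]
    rw [ketbra]
    push_cast
    simp [sq]
  · intro l _ hl
    rw [smul_mul_smul_comm, ketbra_mul_ketbra, w.orthonormal.2 hl.symm]
    simp
  · simp

/-- The probability of the outcome `x` on the state with (unnormalized) components `ξ a`. -/
theorem sum_sum_ketbra_inner {E : Type*} [NormedAddCommGroup E] [InnerProductSpace ℂ E]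
    {ι : Type*} [Fintype ι] (x : ι → ℂ) (ξ : ι → E) :
    ∑ a, ∑ b, (x a * conj (x b)) * ⟪ξ a, ξ b⟫_ℂ =
      ((‖∑ b, conj (x b) • ξ b‖ ^ 2 : ℝ) : ℂ) := by
  have h := inner_self_eq_norm_sq_to_K (𝕜 := ℂ) (∑ b, conj (x b) • ξ b)
  rw [Complex.ofReal_pow]
  refine Eq.trans ?_ h
  rw [sum_inner]
  refine Finset.sum_congr rfl fun a _ => ?_
  rw [inner_sum]
  refine Finset.sum_congr rfl fun b _ => ?_
  rw [inner_smul_left, inner_smul_right, Complex.conj_conj]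
  ring

end Ketbra

/-! ### The `L + 1` rounds influenced by one setting, and the law of one round. -/

section Block

variable {nA N L : ℕ} {H : Type u} [NormedAddCommGroup H] [InnerProductSpace ℂ H]

namespace CorrelatedSource

/-- The overlap of the states that the rounds `u, …, u + L` emit for the settings `a` and `b` of
round `u`, when the other settings are those of `s`. -/
def blockOverlap (src : CorrelatedSource nA N L H) (ε : ℝ) (u : Fin N) (s : Fin N → Fin nA)
    (a b : Fin nA) : ℂ :=
  ∏ m ∈ Finset.range (L + 1), if h : (u : ℕ) + m < N then
    ⟪src.emitted ε ⟨u + m, h⟩ (Function.update s u a),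
      src.emitted ε ⟨u + m, h⟩ (Function.update s u b)⟫_ℂ else 1

theorem inner_φ_self (src : CorrelatedSource nA N L H) (i : Fin nA) :
    ⟪src.φ i, src.φ i⟫_ℂ = 1 := by
  rw [inner_self_eq_norm_sq_to_K, src.φ_norm]; simp

theorem inner_φperp_self (src : CorrelatedSource nA N L H) (u : Fin N) (i : Fin N → Fin nA) :
    ⟪src.φperp u i, src.φperp u i⟫_ℂ = 1 := by
  rw [inner_self_eq_norm_sq_to_K, src.φperp_norm]; simp

theorem inner_φ_φperp (src : CorrelatedSource nA N L H) (u : Fin N) (i : Fin N → Fin nA) :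
    ⟪src.φ (i u), src.φperp u i⟫_ℂ = 0 := by
  rw [← inner_conj_symm, src.φperp_orthogonal, map_zero]

theorem inner_φ_emitted (src : CorrelatedSource nA N L H) (ε : ℝ) (u : Fin N)
    (i : Fin N → Fin nA) : ⟪src.φ (i u), src.emitted ε u i⟫_ℂ = ((√(1 - ε) : ℝ) : ℂ) := by
  rw [emitted, inner_add_right, inner_smul_right, inner_smul_right, inner_φ_φperp, inner_φ_self]
  simp

theorem inner_emitted_self (src : CorrelatedSource nA N L H) {ε : ℝ} (hε0 : 0 ≤ ε) (hε1 : ε ≤ 1)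
    (u : Fin N) (i : Fin N → Fin nA) : ⟪src.emitted ε u i, src.emitted ε u i⟫_ℂ = 1 := by
  rw [emitted, inner_add_right, inner_add_left, inner_add_left]
  simp only [inner_smul_right, inner_smul_left, inner_φ_φperp, inner_φ_self, inner_φperp_self,
    src.φperp_orthogonal, Complex.conj_ofReal, mul_zero, add_zero, zero_add, mul_one]
  rw [← Complex.ofReal_mul, ← Complex.ofReal_mul, Real.mul_self_sqrt hε0,
    Real.mul_self_sqrt (by linarith)]
  push_cast
  ring

theorem emitted_congr (src : CorrelatedSource nA N L H) (ε : ℝ) (u : Fin N)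
    (i i' : Fin N → Fin nA) (h : ∀ v : Fin N, (u : ℕ) ≤ v + L → v ≤ u → i v = i' v) :
    src.emitted ε u i = src.emitted ε u i' := by
  rw [emitted, emitted, src.φperp_window u i i' h, h u (by omega) le_rfl]

/-- The states emitted in the `L + 1` rounds from `u` on are captured by a feasible point; missing
rounds at the end are padded with a fixed state. -/
theorem exists_feasible_block (src : CorrelatedSource nA N L H) {ε : ℝ} (hε0 : 0 ≤ ε)
    (hε1 : ε ≤ 1) (u : Fin N) (s : Fin N → Fin nA) :
    ∃ Φ : Fin nA → tensorPower H (L + 1),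
      (∀ a b, ⟪Φ a, Φ b⟫_ℂ = src.blockOverlap ε u s a b) ∧ (∀ a, ⟪Φ a, Φ a⟫_ℂ = 1) ∧
      ∃ G ∈ feasible src.φ, ∀ i j, rhoA src.p (effectiveEps ε L) G i j =
        ((√(src.p i * src.p j) : ℝ) : ℂ) * ⟪Φ j, Φ i⟫_ℂ := by
  let τ : Fin nA → Fin N → Fin nA := fun a => Function.update s u a
  -- Only the factor `m = 0` depends on `a`, so the products of reference states have the same Gram
  -- matrix as `φ`.
  let ref : Fin nA → Fin (L + 1) → H := fun a m =>
    if h : (u : ℕ) + m < N then src.φ (τ a ⟨u + m, h⟩) else src.φ (s u)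
  -- The padding does not depend on `a`, so it leaves the overlaps unchanged. It overlaps by
  -- `√(1-ε)` with the padding of `ref`, so that a block cut off by the last round still yields the
  -- exponent `L + 1`.
  let st : Fin nA → Fin (L + 1) → H := fun a m =>
    if h : (u : ℕ) + m < N then src.emitted ε ⟨u + m, h⟩ (τ a) else src.emitted ε u s
  -- A unit vector orthogonal to the reference product, through its first factor.
  let pp : Fin nA → Fin (L + 1) → H := fun a m =>
    if m = 0 then src.φperp u (τ a) else ref a m
  have hu0 : ∀ a, ref a 0 = src.φ a := by
    intro a
    simp [ref, τ]
  have hrefsucc : ∀ a b (m : Fin L), ref a m.succ = ref b m.succ := by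
    intro a b m
    simp only [ref, τ]
    split_ifs with h
    · rw [Function.update_of_ne, Function.update_of_ne] <;>
      · intro hc
        have := congrArg Fin.val hc
        simp at this
    · rfl
  have hrefself : ∀ a m, ⟪ref a m, ref a m⟫_ℂ = 1 := by
    intro a m
    simp only [ref]
    split_ifs <;> exact src.inner_φ_self _
  have hstself : ∀ a m, ⟪st a m, st a m⟫_ℂ = 1 := by
    intro a m
    simp only [st]
    split_ifs <;> exact src.inner_emitted_self hε0 hε1 _ _
  have hΦself : ∀ a, ⟪productVector (L + 1) (st a), productVector (L + 1) (st a)⟫_ℂ = 1 := by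
    intro a
    rw [inner_productVector]
    exact Finset.prod_eq_one fun m _ => hstself a m
  have hpow0 : 0 ≤ 1 - ε := by linarith
  have hpow1 : (1 - ε) ^ (L + 1) ≤ 1 := pow_le_one₀ hpow0 (by linarith)
  refine ⟨fun a => productVector (L + 1) (st a), fun a b => ?_, hΦself, ?_⟩
  · rw [inner_productVector, blockOverlap, ← Fin.prod_univ_eq_prod_range (fun m =>
      if h : (u : ℕ) + m < N then ⟪src.emitted ε ⟨u + m, h⟩ (Function.update s u a),
      src.emitted ε ⟨u + m, h⟩ (Function.update s u b)⟫_ℂ else 1)]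
    refine Finset.prod_congr rfl fun m _ => ?_
    simp only [st]
    split_ifs
    · rfl
    · exact src.inner_emitted_self hε0 hε1 _ _
  · refine (exists_feasible_of_vectors (φ := src.φ) (ε := effectiveEps ε L)
      (R := fun a => productVector (L + 1) (ref a)) (Φ := fun a => productVector (L + 1) (st a))
      (Q := fun a => productVector (L + 1) (pp a)) (by rw [effectiveEps]; linarith)
      (by rw [effectiveEps]; linarith [pow_nonneg hpow0 (L + 1)]) ?_ src.φ_norm hΦself ?_ ?_ ?_).imp
      fun G hG => ⟨hG.1, hG.2 src.p⟩
    · intro i j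
      rw [inner_productVector, Fin.prod_univ_succ, hu0, hu0, Finset.prod_eq_one, mul_one]
      intro m _
      rw [hrefsucc i j m]
      exact hrefself _ _
    · intro i
      have : ∀ m, ⟪ref i m, st i m⟫_ℂ = ((√(1 - ε) : ℝ) : ℂ) := by
        intro m
        simp only [ref, st]
        split_ifs
        · exact src.inner_φ_emitted ε _ _
        · exact src.inner_φ_emitted ε _ _
      rw [inner_productVector, Finset.prod_congr rfl fun m _ => this m, Finset.prod_const,
        Finset.card_univ, Fintype.card_fin, ← Complex.ofReal_pow]
      congr 1
      rw [effectiveEps, sub_sub_cancel]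
      rw [eq_comm, Real.sqrt_eq_iff_mul_self_eq (pow_nonneg hpow0 _)
        (pow_nonneg (Real.sqrt_nonneg _) _), ← mul_pow, Real.mul_self_sqrt hpow0]
    · intro i
      rw [inner_productVector]
      refine Finset.prod_eq_one fun m _ => ?_
      simp only [pp]
      split_ifs
      · exact src.inner_φperp_self _ _
      · exact hrefself _ _
    · intro i
      rw [inner_productVector]
      refine Finset.prod_eq_zero (Finset.mem_univ 0) ?_
      simp only [pp, if_true, hu0]
      have := src.inner_φ_φperp u (τ i)
      simpa [τ] using this

/-- The law of the `W`-measurement of round `u`, conditioned on the settings outside its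
residue class. -/
theorem exists_outcome_law (src : CorrelatedSource nA N L H) {ε : ℝ} (hε0 : 0 ≤ ε)
    (hε1 : ε ≤ 1) (w : OrthonormalBasis (Fin nA) ℂ (EuclideanSpace ℂ (Fin nA)))
    (u : Fin N) (s : Fin N → Fin nA) :
    ∃ q : Fin nA → ℝ, (∀ k, 0 ≤ q k) ∧ ∑ k, q k = 1 ∧
      (∀ k, ∑ a, ∑ b, ketbra (w k) a b * (((√(src.p a) * √(src.p b) : ℝ) : ℂ) *
        src.blockOverlap ε u s a b) = q k) ∧
      ∃ G ∈ feasible src.φ, ∀ ω : Fin nA → ℝ,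
        ((∑ k, (ω k : ℂ) • ketbra (w k)) * rhoA src.p (effectiveEps ε L) G).trace.re =
          ∑ k, ω k * q k := by
  obtain ⟨Φ, hΦ, hΦ1, G, hG, hρ⟩ := src.exists_feasible_block hε0 hε1 u s
  -- Born's rule for Alice's measurement on the one-round state `∑ b, √(p b) |b⟩ ⊗ Φ b`, whose
  -- reduced state is `rhoA`.
  let q : Fin nA → ℝ := fun k => ‖∑ b, conj (w k b) • ((√(src.p b) : ℝ) : ℂ) • Φ b‖ ^ 2
  have hq : ∀ k, ∑ a, ∑ b, ketbra (w k) a b * (((√(src.p a) * √(src.p b) : ℝ) : ℂ) *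
      src.blockOverlap ε u s a b) = q k := by
    intro k
    rw [← sum_sum_ketbra_inner (fun b => w k b) fun b => ((√(src.p b) : ℝ) : ℂ) • Φ b]
    refine Finset.sum_congr rfl fun a _ => Finset.sum_congr rfl fun b _ => ?_
    rw [inner_smul_left, inner_smul_right, hΦ, Complex.conj_ofReal, ketbra, Matrix.of_apply]
    push_cast
    ring
  refine ⟨q, fun k => by positivity, ?_, hq, G, hG, fun ω => ?_⟩
  · have h1 : ((∑ k, q k : ℝ) : ℂ) = 1 := by
      push_cast
      simp_rw [← hq]
      rw [Finset.sum_comm]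
      rw [Finset.sum_congr rfl fun a _ => Finset.sum_comm]
      simp_rw [← Finset.sum_mul, ← Matrix.sum_apply, sum_ketbra, Matrix.one_apply, ite_mul,
        one_mul, zero_mul, Finset.sum_ite_eq, Finset.mem_univ, if_true]
      rw [← Complex.ofReal_one, ← src.p_sum, Complex.ofReal_sum]
      refine Finset.sum_congr rfl fun a _ => ?_
      rw [← hΦ, hΦ1, mul_one, Real.mul_self_sqrt (src.p_nonneg a)]
    exact_mod_cast h1
  · have h1 : ((∑ k, (ω k : ℂ) • ketbra (w k)) * rhoA src.p (effectiveEps ε L) G).trace =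
        ((∑ k, ω k * q k : ℝ) : ℂ) := by
      rw [Finset.sum_mul, Matrix.trace_sum]
      push_cast
      refine Finset.sum_congr rfl fun k _ => ?_
      rw [Matrix.smul_mul, Matrix.trace_smul, smul_eq_mul, ← hq]
      congr 1
      rw [Matrix.trace]
      refine Finset.sum_congr rfl fun a _ => ?_
      rw [Matrix.diag_apply, Matrix.mul_apply]
      refine Finset.sum_congr rfl fun b _ => ?_
      rw [hρ, hΦ, mul_comm (src.p b), Real.sqrt_mul (src.p_nonneg a)]
    rw [h1, Complex.ofReal_re]

end CorrelatedSource

end Block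

/-! ### Merging outcomes in a multilinear law. -/

section Relabel

variable {ι R V M O κ : Type*} [Fintype ι] [DecidableEq ι] [CommSemiring R] [AddCommMonoid V]
  [Module R V] [AddCommMonoid M] [Module R M] [Fintype O] [Fintype κ] [DecidableEq κ]

open Classical in
/-- Outcomes that an event does not distinguish may be merged, by adding up their operators. -/
theorem sum_multilinear_eq_sum_labels (Λ : MultilinearMap R (fun _ : ι => V) M) (X : O → V)
    (cl : O → κ) (S : Set (ι → κ)) :
    ∑ o : ι → O with (fun u => cl (o u)) ∈ S, Λ (fun u => X (o u)) =
      ∑ k with k ∈ S, Λ fun u => ∑ o with cl o = k u, X o := by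
  rw [← Finset.sum_fiberwise_of_maps_to
    (t := Finset.univ.filter (· ∈ S)) (g := fun (o : ι → O) u => cl (o u))
    (by intro o ho; simpa using ho)]
  refine Finset.sum_congr rfl fun k hk => ?_
  rw [Λ.map_sum_finset]
  refine Finset.sum_congr ?_ fun _ _ => rfl
  ext o
  simp only [Finset.mem_filter, Finset.mem_univ, true_and, Fintype.mem_piFinset, funext_iff]
  constructor
  · exact fun h => h.2
  · intro h
    refine ⟨?_, h⟩
    rw [funext h]
    simpa using hk

end Relabel

/-! ### Born's rule as a multilinear functional, and removal of Bob and the channel. -/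

section Born

variable {nA nM N L : ℕ} {HC : Type u} {HB : Type v}
  [NormedAddCommGroup HC] [InnerProductSpace ℂ HC]
  [NormedAddCommGroup HB] [InnerProductSpace ℂ HB]

/-- The functional `T ↦ ⟨x| 𝒞†(T) |y⟩`. -/
def matrixCoefficient (𝒞 : Channel HC HB N) (x y : tensorPower HC N) :
    (tensorPower HB N →L[ℂ] tensorPower HB N) →ₗ[ℂ] ℂ where
  toFun T := ⟪x, 𝒞.dual T y⟫_ℂ
  map_add' S T := by rw [map_add, _root_.add_apply, inner_add_right]
  map_smul' c T := by
    rw [map_smul, _root_.smul_apply, inner_smul_right]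
    rfl

/-- The expectation value of a product of round operators, each given as a matrix of operators
of Bob, as a multilinear map. -/
def bornFunctional (src : CorrelatedSource nA N L HC) (ε : ℝ) (𝒞 : Channel HC HB N) :
    MultilinearMap ℂ (fun _ : Fin N => Fin nA → Fin nA → (HB →L[ℂ] HB)) ℂ :=
  ∑ i : Fin N → Fin nA, ∑ j : Fin N → Fin nA,
    (matrixCoefficient 𝒞 (src.globalState ε i) (src.globalState ε j)).compMultilinearMap
      ((productOperatorMultilinear N).compLinearMap fun u =>
        (LinearMap.proj (R := ℂ) (φ := fun _ : Fin nA => HB →L[ℂ] HB) (j u)).comp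
          (LinearMap.proj (R := ℂ) (φ := fun _ : Fin nA => Fin nA → (HB →L[ℂ] HB)) (i u)))

theorem bornFunctional_apply (src : CorrelatedSource nA N L HC) (ε : ℝ) (𝒞 : Channel HC HB N)
    (X : Fin N → Fin nA → Fin nA → (HB →L[ℂ] HB)) :
    bornFunctional src ε 𝒞 X = ∑ i : Fin N → Fin nA, ∑ j : Fin N → Fin nA,
      ⟪src.globalState ε i, 𝒞.dual (productOperator N fun u => X u (i u) (j u))
        (src.globalState ε j)⟫_ℂ := by
  simp only [bornFunctional, _root_.sum_apply]
  rfl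

theorem bornFunctional_smul (src : CorrelatedSource nA N L HC) (ε : ℝ) (𝒞 : Channel HC HB N)
    (D : Fin N → Fin nA → Fin nA → ℂ) (B : Fin N → (HB →L[ℂ] HB)) :
    bornFunctional src ε 𝒞 (fun u a b => D u a b • B u) =
      ∑ i : Fin N → Fin nA, ∑ j : Fin N → Fin nA, (∏ u, D u (i u) (j u)) *
        ⟪src.globalState ε i, 𝒞.dual (productOperator N B) (src.globalState ε j)⟫_ℂ := by
  rw [bornFunctional_apply]
  refine Finset.sum_congr rfl fun i _ => Finset.sum_congr rfl fun j _ => ?_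
  have h : productOperator N (fun u => D u (i u) (j u) • B u) =
      (∏ u, D u (i u) (j u)) • productOperator N B :=
    (productOperatorMultilinear (H := HB) N).map_smul_univ _ B
  rw [h]
  exact (matrixCoefficient 𝒞 (src.globalState ε i) (src.globalState ε j)).map_smul _ _

/-- No-signalling: when Bob's factors are trivial, unitality of the dual channel leaves only the
Gram matrix of the components of the global state. -/
theorem bornFunctional_smul_one (src : CorrelatedSource nA N L HC) (ε : ℝ)
    (𝒞 : Channel HC HB N) (D : Fin N → Fin nA → Fin nA → ℂ) :
    bornFunctional src ε 𝒞 (fun u a b => D u a b • 1) =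
      ∑ i : Fin N → Fin nA, ∑ j : Fin N → Fin nA, (∏ u, D u (i u) (j u)) *
        ⟪src.globalState ε i, src.globalState ε j⟫_ℂ := by
  rw [bornFunctional_smul src ε 𝒞 D fun _ => 1]
  simp only [productOperator_one, 𝒞.dual_one, one_apply_eq_self]

theorem inner_globalState (src : CorrelatedSource nA N L HC) (ε : ℝ) (i j : Fin N → Fin nA) :
    ⟪src.globalState ε i, src.globalState ε j⟫_ℂ =
      (∏ u, ((√(src.p (i u)) * √(src.p (j u)) : ℝ) : ℂ)) *
        ∏ u, ⟪src.emitted ε u i, src.emitted ε u j⟫_ℂ := by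
  simp only [CorrelatedSource.globalState]
  rw [inner_smul_left, inner_smul_right, inner_productVector, Complex.conj_ofReal]
  push_cast
  rw [Finset.prod_mul_distrib]
  ring

variable [CompleteSpace HB]

/-- The POVM element of an outcome, as a matrix of operators of Bob. -/
def roundOperator (hnA : 2 ≤ nA) (bob : BobDevice nM HB) (α : ℝ)
    (w : Fin nA → EuclideanSpace ℂ (Fin nA)) (o : Outcome nA nM) (a b : Fin nA) : HB →L[ℂ] HB :=
  ((outcomeWeight bob α o : ℂ) * aliceOperator hnA w o a b) • bobOperator bob o

theorem outcomeProb_eq (hnA : 2 ≤ nA) (src : CorrelatedSource nA N L HC) (ε : ℝ)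
    (bob : BobDevice nM HB) (𝒞 : Channel HC HB N) (α : ℝ)
    (w : Fin nA → EuclideanSpace ℂ (Fin nA)) (o : Fin N → Outcome nA nM) :
    outcomeProb hnA src ε bob 𝒞 α w o =
      (bornFunctional src ε 𝒞 fun u => roundOperator hnA bob α w (o u)).re := by
  have h := bornFunctional_smul src ε 𝒞
    (fun u a b => (outcomeWeight bob α (o u) : ℂ) * aliceOperator hnA w (o u) a b)
    fun u => bobOperator bob (o u)
  refine Eq.trans ?_ (congrArg Complex.re h.symm)
  simp only [Finset.prod_mul_distrib, mul_assoc, ← Finset.mul_sum]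
  rw [← Complex.ofReal_prod, Complex.re_ofReal_mul]
  rfl

/-- The eigenvector of `W` that a round outcome reports, if any. -/
def eigenLabel : Outcome nA nM → Option (Fin nA)
  | .inl _ => none
  | .inr (.inl _) => none
  | .inr (.inr k) => some k

theorem chiW_eq (ω : Fin nA → ℝ) (o : Outcome nA nM) : chiW ω o = (eigenLabel o).elim 0 ω := by
  rcases o with _ | _ | _ <;> rfl

/-! The simplified measurement has outcomes in `Bool × Fin nA`: it always measures in the basis `w`,
and records the result with probability `α`. -/

/-- The probability of recording (`true`) or discarding (`false`) the result. -/
def localWeight (α : ℝ) (f : Bool) : ℝ := if f then α else 1 - α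

def localLabel (o : Bool × Fin nA) : Option (Fin nA) := if o.1 then some o.2 else none

def localValue (ω : Fin nA → ℝ) (o : Bool × Fin nA) : ℝ := if o.1 then ω o.2 else 0

theorem localValue_eq (ω : Fin nA → ℝ) (o : Bool × Fin nA) :
    localValue ω o = (localLabel o).elim 0 ω := by
  rcases o with ⟨_ | _, k⟩ <;> rfl

def localOperator (α : ℝ) (w : Fin nA → EuclideanSpace ℂ (Fin nA)) (o : Bool × Fin nA)
    (a b : Fin nA) : HB →L[ℂ] HB :=
  ((localWeight α o.1 : ℂ) * ketbra (w o.2) a b) • 1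

/-- Both the Hadamard states and the settings `0` and `1` are orthonormal bases of the same plane.
Hence Alice's virtual key projectors have the same sum as the sifted ones. -/
theorem sum_ketbra_hadamard (hnA : 2 ≤ nA) (a b : Fin nA) :
    ∑ i, ketbra (hadamard hnA i) a b = if a = b ∧ (a : ℕ) < 2 then 1 else 0 := by
  have h2 : (((√2)⁻¹ : ℝ) : ℂ) * (((√2)⁻¹ : ℝ) : ℂ) = 1 / 2 := by
    rw [← Complex.ofReal_mul, ← mul_inv, Real.mul_self_sqrt (by norm_num)]
    norm_num
  have h : ∀ (i : Fin 2) (c : Fin nA), hadamard hnA i c = (((√2)⁻¹ : ℝ) : ℂ) *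
      ((if (c : ℕ) = 0 then 1 else 0) + if (c : ℕ) = 1 then (-1) ^ (i : ℕ) else 0) := by
    intro i c
    simp [hadamard, Fin.ext_iff, EuclideanSpace.single, mul_add]
  simp only [ketbra, Matrix.of_apply, h, map_mul, Complex.conj_ofReal, Fin.sum_univ_two, Fin.ext_iff]
  have : ∀ x y z t : ℂ, ((((√2)⁻¹ : ℝ) : ℂ) * x) * ((((√2)⁻¹ : ℝ) : ℂ) * y) +
      ((((√2)⁻¹ : ℝ) : ℂ) * z) * ((((√2)⁻¹ : ℝ) : ℂ) * t) = (x * y + z * t) / 2 := by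
    intro x y z t
    linear_combination (x * y + z * t) * h2
  rw [this]
  by_cases ha0 : (a : ℕ) = 0 <;> by_cases ha1 : (a : ℕ) = 1 <;> by_cases hb0 : (b : ℕ) = 0 <;>
    by_cases hb1 : (b : ℕ) = 1 <;> simp [ha0, ha1, hb0, hb1] <;> omega

/-- Bob's counterpart: the no-detection elements agree and both POVMs sum to `1`. -/
theorem sum_detected (bob : BobDevice nM HB) :
    ∑ b : Fin 2, bob.ΓV (some b) = ∑ b : Fin 2, bob.Γ 0 (some b) := by
  have h1 := bob.ΓV_sum
  have h2 := bob.Γ_sum 0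
  rw [Fintype.sum_option] at h1 h2
  rw [bob.ΓV_none] at h1
  exact add_left_cancel (h1.trans h2.symm)

theorem ketbra_single (c a b : Fin nA) :
    ketbra (EuclideanSpace.single c 1) a b = if a = c ∧ a = b then 1 else 0 := by
  simp only [ketbra, Matrix.of_apply, EuclideanSpace.single, PiLp.single_apply]
  by_cases h1 : a = c <;> by_cases h2 : b = c <;> simp [h1, h2]; tauto

/-- The test outcomes together with the virtual key outcomes complete the measurement. -/
theorem sum_unlabelled (hnA : 2 ≤ nA) (bob : BobDevice nM HB) (α : ℝ)
    (w : Fin nA → EuclideanSpace ℂ (Fin nA)) (a b : Fin nA) :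
    ∑ x : Fin 2 × Fin 2, roundOperator (nM := nM) hnA bob α w (.inl x) a b +
      ∑ t : {t : Fin nA × Fin (nM + 1) × Option (Fin 2) // ¬ IsKey t},
        roundOperator hnA bob α w (.inr (.inl t)) a b =
      if a = b then ((1 - α : ℝ) : ℂ) • 1 else 0 := by
  have hkey : ∑ x : Fin 2 × Fin 2, roundOperator (nM := nM) hnA bob α w (.inl x) a b =
      ∑ t : {t : Fin nA × Fin (nM + 1) × Option (Fin 2) // IsKey t},
        (((((1 - α) * bob.pB t.1.2.1 : ℝ) : ℂ) * if a = t.1.1 ∧ a = b then 1 else 0) •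
          bob.Γ t.1.2.1 t.1.2.2) := by
    have hL : ∑ x : Fin 2 × Fin 2, roundOperator (nM := nM) hnA bob α w (.inl x) a b =
        ((((1 - α) * bob.pB 0 : ℝ) : ℂ) * if a = b ∧ (a : ℕ) < 2 then 1 else 0) •
          ∑ b : Fin 2, bob.Γ 0 (some b) := by
      rw [Fintype.sum_prod_type, ← sum_ketbra_hadamard hnA, ← sum_detected, Finset.mul_sum,
        Finset.sum_smul]
      refine Finset.sum_congr rfl fun i _ => ?_
      rw [Finset.smul_sum]
      rfl
    rw [hL]
    refine Eq.trans ?_ (Finset.sum_subtype (Finset.univ.filter IsKey) (by simp)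
      fun t : Fin nA × Fin (nM + 1) × Option (Fin 2) =>
        ((((1 - α) * bob.pB t.2.1 : ℝ) : ℂ) * if a = t.1 ∧ a = b then 1 else 0) •
          bob.Γ t.2.1 t.2.2)
    rw [Finset.sum_filter, Fintype.sum_prod_type, Finset.sum_eq_single a, Fintype.sum_prod_type,
      Finset.sum_eq_single (0 : Fin (nM + 1)), Fintype.sum_option]
    · simp only [IsKey, Fin.sum_univ_two]
      by_cases hab : a = b
      · subst hab
        by_cases ha : (a : ℕ) < 2 <;> simp [ha]
      · simp [hab]
    · intro β _ hβ
      simp [IsKey, hβ]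
    · simp
    · intro c _ hc
      simp [hc.symm]
    · simp
  rw [hkey]
  have hall := Fintype.sum_subtype_add_sum_subtype (IsKey (nA := nA) (nM := nM))
    fun t => ((((1 - α) * bob.pB t.2.1 : ℝ) : ℂ) * if a = t.1 ∧ a = b then 1 else 0) •
      bob.Γ t.2.1 t.2.2
  have hrest : ∀ t : {t : Fin nA × Fin (nM + 1) × Option (Fin 2) // ¬ IsKey t},
      roundOperator hnA bob α w (.inr (.inl t)) a b =
        ((((1 - α) * bob.pB t.1.2.1 : ℝ) : ℂ) * if a = t.1.1 ∧ a = b then 1 else 0) •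
          bob.Γ t.1.2.1 t.1.2.2 := by
    intro t
    simp only [roundOperator, aliceOperator, bobOperator, outcomeWeight, ketbra_single]
  have hsum : ∀ c : Fin nA, ∑ x : Fin (nM + 1) × Option (Fin 2),
      ((((1 - α) * bob.pB x.1 : ℝ) : ℂ) * if a = c ∧ a = b then 1 else 0) • bob.Γ x.1 x.2 =
        (((1 - α : ℝ) : ℂ) * if a = c ∧ a = b then 1 else 0) • 1 := by
    intro c
    rw [Fintype.sum_prod_type]
    simp only
    rw [Finset.sum_congr rfl fun β _ => by rw [← Finset.smul_sum, bob.Γ_sum], ← Finset.sum_smul,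
      ← Finset.sum_mul, ← Complex.ofReal_sum, ← Finset.mul_sum, bob.pB_sum, mul_one]
  rw [Finset.sum_congr rfl fun t _ => hrest t, hall, Fintype.sum_prod_type,
    Finset.sum_congr rfl fun c _ => hsum c, ← Finset.sum_smul]
  split_ifs with hab
  · simp only [hab, and_true, Finset.sum_ite_eq, Finset.mem_univ, if_true, mul_one,
      mul_ite, mul_zero]
  · simp [hab]

/-- Once outcomes are merged by label, both measurements have the elements `α |w k⟩⟨w k| ⊗ 1` and,
for no label, `(1 - α) • 1`. -/
theorem sum_roundOperator_eq (hnA : 2 ≤ nA) (bob : BobDevice nM HB) (α : ℝ)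
    (w : OrthonormalBasis (Fin nA) ℂ (EuclideanSpace ℂ (Fin nA))) (k : Option (Fin nA)) :
    ∑ o with eigenLabel o = k, roundOperator (nM := nM) hnA bob α w o =
      ∑ o with localLabel o = k, localOperator α w o := by
  ext1 a
  ext1 b
  rw [Finset.sum_apply, Finset.sum_apply, Finset.sum_apply, Finset.sum_apply,
    Finset.sum_filter, Finset.sum_filter, Fintype.sum_sum_type, Fintype.sum_sum_type,
    Fintype.sum_prod_type (α₁ := Bool), Fintype.sum_bool]
  rcases k with _ | k
  · simp only [eigenLabel, localLabel, reduceCtorEq, if_true, if_false, Finset.sum_const_zero,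
      add_zero, zero_add, Bool.false_eq_true]
    rw [sum_unlabelled]
    simp only [localOperator, localWeight, Bool.false_eq_true, if_false]
    rw [← Finset.sum_smul, ← Finset.mul_sum, ← Matrix.sum_apply, sum_ketbra, Matrix.one_apply]
    split_ifs <;> simp
  · simp only [eigenLabel, localLabel, reduceCtorEq, if_true, if_false, Finset.sum_const_zero,
      add_zero, zero_add, Bool.false_eq_true, Option.some.injEq, Finset.sum_ite_eq',
      Finset.mem_univ]
    rfl

/-- The law of the simplified measurement. -/
def localProb (src : CorrelatedSource nA N L HC) (ε : ℝ) (𝒞 : Channel HC HB N) (α : ℝ)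
    (w : Fin nA → EuclideanSpace ℂ (Fin nA)) (o : Fin N → Bool × Fin nA) : ℝ :=
  (bornFunctional src ε 𝒞 fun u => localOperator α w (o u)).re

/-- The channel drops out, and what remains is a product of weights times a squared norm. -/
theorem localProb_nonneg (src : CorrelatedSource nA N L HC) (ε : ℝ) (𝒞 : Channel HC HB N)
    {α : ℝ} (hα0 : 0 ≤ α) (hα1 : α ≤ 1) (w : Fin nA → EuclideanSpace ℂ (Fin nA))
    (o : Fin N → Bool × Fin nA) : 0 ≤ localProb src ε 𝒞 α w o := by
  have h := bornFunctional_smul_one src ε 𝒞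
    fun u a b => (localWeight α (o u).1 : ℂ) * ketbra (w (o u).2) a b
  have h2 := sum_sum_ketbra_inner (fun i : Fin N → Fin nA => ∏ u, w (o u).2 (i u))
    fun i => src.globalState ε i
  have h3 : localProb src ε 𝒞 α w o = (∏ u, localWeight α (o u).1) *
      ‖∑ i : Fin N → Fin nA, conj (∏ u, w (o u).2 (i u)) • src.globalState ε i‖ ^ 2 := by
    refine (congrArg Complex.re h).trans ?_
    simp only [Finset.prod_mul_distrib, mul_assoc, ← Finset.mul_sum]
    rw [← Complex.ofReal_prod, Complex.re_ofReal_mul]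
    congr 1
    rw [← Complex.ofReal_re (‖_‖ ^ 2), ← h2]
    congr 1
    refine Finset.sum_congr rfl fun i _ => Finset.sum_congr rfl fun j _ => ?_
    rw [map_prod, ← Finset.prod_mul_distrib]
    rfl
  rw [h3]
  refine mul_nonneg (Finset.prod_nonneg fun u _ => ?_) (by positivity)
  rw [localWeight]
  split_ifs <;> linarith

open Classical in
theorem prob_eq_sum_localProb (hnA : 2 ≤ nA) (src : CorrelatedSource nA N L HC) (ε : ℝ)
    (bob : BobDevice nM HB) (𝒞 : Channel HC HB N) (α : ℝ)
    (w : OrthonormalBasis (Fin nA) ℂ (EuclideanSpace ℂ (Fin nA))) (ω : Fin nA → ℝ) (T : ℝ) :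
    prob hnA src ε bob 𝒞 α w {o | T ≤ MW ω o} =
      ∑ o with T ≤ ∑ u, localValue ω (o u), localProb src ε 𝒞 α w o := by
  let S : Set (Fin N → Option (Fin nA)) := {k | T ≤ ∑ u, (k u).elim 0 ω}
  have h1 := sum_multilinear_eq_sum_labels (bornFunctional src ε 𝒞)
    (roundOperator (nM := nM) hnA bob α w) eigenLabel S
  have h2 := sum_multilinear_eq_sum_labels (bornFunctional src ε 𝒞)
    (localOperator α w) localLabel S
  simp only [sum_roundOperator_eq] at h1
  have h := congrArg Complex.re (h1.trans h2.symm)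
  rw [Complex.re_sum, Complex.re_sum] at h
  rw [prob]
  refine Eq.trans (Finset.sum_congr ?_ fun o _ => outcomeProb_eq ..) (h.trans
    (Finset.sum_congr ?_ fun o _ => rfl))
  · ext o
    simp [S, MW, chiW_eq]
  · ext o
    simp [S, localValue_eq]

end Born

/-! ### The moment generating function of one residue class. -/

section Mgf

variable {nA nM N L : ℕ} {HC : Type u} {HB : Type v}
  [NormedAddCommGroup HC] [InnerProductSpace ℂ HC]
  [NormedAddCommGroup HB] [InnerProductSpace ℂ HB] [CompleteSpace HB]

/-- The setting sequence with entries `a` in the residue class `r` and `s` outside. -/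
def mergeSettings (r : ℕ) (a : {u : Fin N // (u : ℕ) % (L + 1) = r} → Fin nA)
    (s : {u : Fin N // ¬ (u : ℕ) % (L + 1) = r} → Fin nA) : Fin N → Fin nA :=
  (Equiv.piEquivPiSubtypeProd (fun u : Fin N => (u : ℕ) % (L + 1) = r) fun _ => Fin nA).symm (a, s)

theorem mergeSettings_mem {r : ℕ} (a : {u : Fin N // (u : ℕ) % (L + 1) = r} → Fin nA)
    (s : {u : Fin N // ¬ (u : ℕ) % (L + 1) = r} → Fin nA)
    (u : {u : Fin N // (u : ℕ) % (L + 1) = r}) :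
    mergeSettings r a s u = a u := by
  simp [mergeSettings, Equiv.piEquivPiSubtypeProd, u.2]

theorem mergeSettings_congr {r : ℕ} (a b : {u : Fin N // (u : ℕ) % (L + 1) = r} → Fin nA)
    (s : {u : Fin N // ¬ (u : ℕ) % (L + 1) = r} → Fin nA) (v : Fin N)
    (hv : (v : ℕ) % (L + 1) ≠ r) : mergeSettings r a s v = mergeSettings r b s v := by
  simp [mergeSettings, Equiv.piEquivPiSubtypeProd, hv]

/-- Two rounds of the same residue class within distance `L` coincide. -/
theorem eq_of_mod_eq_of_near {L x y : ℕ} (h : x % (L + 1) = y % (L + 1)) (hxy : x ≤ y + L)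
    (hyx : y ≤ x + L) : x = y := by
  have hx := Nat.div_add_mod x (L + 1)
  have hy := Nat.div_add_mod y (L + 1)
  have : x / (L + 1) = y / (L + 1) := by
    by_contra hne
    rcases Nat.lt_or_gt_of_ne hne with h' | h'
    · have := Nat.mul_le_mul_left (L + 1) (Nat.succ_le_of_lt h')
      rw [Nat.mul_succ] at this
      omega
    · have := Nat.mul_le_mul_left (L + 1) (Nat.succ_le_of_lt h')
      rw [Nat.mul_succ] at this
      omega
  rw [this] at hx
  omega

/-- For fixed settings outside a residue class, the overlaps of the emitted states factorize over
the rounds of that class. -/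
theorem prod_inner_emitted (src : CorrelatedSource nA N L HC) {ε : ℝ} (hε0 : 0 ≤ ε)
    (hε1 : ε ≤ 1) {r : ℕ} (hr : r < L + 1)
    (a b c : {u : Fin N // (u : ℕ) % (L + 1) = r} → Fin nA)
    (s : {u : Fin N // ¬ (u : ℕ) % (L + 1) = r} → Fin nA) :
    ∏ v, ⟪src.emitted ε v (mergeSettings r a s), src.emitted ε v (mergeSettings r b s)⟫_ℂ =
      ∏ u : {u : Fin N // (u : ℕ) % (L + 1) = r},
        src.blockOverlap ε u (mergeSettings r c s) (a u) (b u) := by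
  let F : ℕ → ℂ := fun v => if h : v < N then
    ⟪src.emitted ε ⟨v, h⟩ (mergeSettings r a s),
      src.emitted ε ⟨v, h⟩ (mergeSettings r b s)⟫_ℂ else 1
  have hF : ∀ v : Fin N, ⟪src.emitted ε v (mergeSettings r a s),
      src.emitted ε v (mergeSettings r b s)⟫_ℂ = F v := by
    intro v
    simp [F]
  -- No round of the class is at or before `v < r`, so both settings yield the same emitted state.
  have hFlt : ∀ v, v < r → F v = 1 := by
    intro v hv
    simp only [F]
    split_ifs with h
    · rw [src.emitted_congr ε ⟨v, h⟩ (mergeSettings r a s) (mergeSettings r b s)]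
      · exact src.inner_emitted_self hε0 hε1 _ _
      · intro v' _ hv'
        apply mergeSettings_congr
        have : (v' : ℕ) ≤ v := hv'
        rw [Nat.mod_eq_of_lt (by omega)]
        omega
    · rfl
  rw [Finset.prod_congr rfl fun v _ => hF v, Fin.prod_univ_eq_prod_range F,
    prod_range_eq_prod_blocks F hr (fun v hv => dif_neg (by omega)) hFlt, Finset.prod_filter,
    ← Fin.prod_univ_eq_prod_range (fun u => if u % (L + 1) = r then
      ∏ m ∈ Finset.range (L + 1), F (u + m) else 1), ← Finset.prod_filter,
    Finset.prod_subtype (p := fun u : Fin N => (u : ℕ) % (L + 1) = r) _ (by simp)]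
  refine Finset.prod_congr rfl fun u _ => ?_
  rw [CorrelatedSource.blockOverlap]
  refine Finset.prod_congr rfl fun m hm => ?_
  rw [Finset.mem_range] at hm
  -- The window of round `u + m` has length `L + 1` and contains `u`, hence no other round of the
  -- class. The class entries other than that of `u` may therefore be replaced by the arbitrary `c`.
  have hcongr : ∀ (d : {u : Fin N // (u : ℕ) % (L + 1) = r} → Fin nA)
      (h : ((u : Fin N) : ℕ) + m < N),
      src.emitted ε ⟨(u : Fin N) + m, h⟩ (mergeSettings r d s) =
        src.emitted ε ⟨(u : Fin N) + m, h⟩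
          (Function.update (mergeSettings r c s) u (d u)) := by
    intro d h
    apply src.emitted_congr
    intro v h1 h2
    by_cases hv : v = u
    · rw [hv, Function.update_self, mergeSettings_mem]
    · rw [Function.update_of_ne hv]
      apply mergeSettings_congr
      intro hmod
      apply hv
      have h2' : (v : ℕ) ≤ (u : Fin N) + m := h2
      simp only at h1
      exact Fin.ext (eq_of_mod_eq_of_near (hmod.trans u.2.symm) (by omega) (by omega))
  simp only [F]
  split_ifs with h
  · rw [hcongr a h, hcongr b h]
  · rfl

theorem localValue_le_omegaMax (ω : Fin nA → ℝ) (o : Bool × Fin nA) :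
    localValue ω o ≤ omegaMax ω := by
  apply Finset.le_max'
  rw [localValue, chiValues]
  split_ifs <;> simp

/-- The base on the left is the point of `[EL, EU]` closest to `0`. -/
theorem sq_le_sq_of_mem_Icc {EL EU μ : ℝ} (h1 : EL ≤ μ) (h2 : μ ≤ EU) :
    (max 0 EL + min 0 EU) ^ 2 ≤ μ ^ 2 := by
  rcases le_total 0 EL with h | h
  · rw [max_eq_right h, min_eq_left (by linarith)]
    nlinarith
  · rw [max_eq_left h]
    rcases le_total 0 EU with h' | h'
    · rw [min_eq_left h']
      nlinarith [sq_nonneg μ]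
    · rw [min_eq_right h']
      nlinarith

/-- The constraints on the parameters that the semidefinite programs guarantee for every possible
law of a round. -/
structure RoundBounds (nA : ℕ) (α : ℝ) (ω : Fin nA → ℝ) (EL EU E2U : ℝ) (q : Fin nA → ℝ) :
    Prop where
  nonneg : ∀ k, 0 ≤ q k
  sum_eq : ∑ k, q k = 1
  le_mean : EL ≤ α * ∑ k, ω k * q k
  mean_le : α * ∑ k, ω k * q k ≤ EU
  sq_mean_le : α * ∑ k, ω k ^ 2 * q k ≤ E2U

variable {α : ℝ} {ω : Fin nA → ℝ} {EL EU E2U : ℝ} {q : Fin nA → ℝ}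

theorem sum_localWeight_mul (α : ℝ) (q : Fin nA → ℝ) (f : Bool × Fin nA → ℝ) :
    ∑ o : Bool × Fin nA, localWeight α o.1 * q o.2 * f o =
      α * ∑ k, q k * f (true, k) + (1 - α) * ∑ k, q k * f (false, k) := by
  rw [Fintype.sum_prod_type, Fintype.sum_bool]
  simp only [localWeight, Finset.mul_sum, mul_assoc, if_true, Bool.false_eq_true, if_false]

theorem sum_localWeight_mul_localValue (α : ℝ) (q : Fin nA → ℝ) (ω : Fin nA → ℝ) {n : ℕ}
    (hn : n ≠ 0) :
    ∑ o : Bool × Fin nA, localWeight α o.1 * q o.2 * localValue ω o ^ n =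
      α * ∑ k, ω k ^ n * q k := by
  rw [sum_localWeight_mul α q fun o => localValue ω o ^ n]
  simp [localValue, hn, mul_comm]

theorem RoundBounds.variance_le (h : RoundBounds nA α ω EL EU E2U q) :
    α * ∑ k, ω k ^ 2 * q k - (α * ∑ k, ω k * q k) ^ 2 ≤ vBound EL EU E2U := by
  have := sq_le_sq_of_mem_Icc h.le_mean h.mean_le
  rw [vBound]
  linarith [h.sq_mean_le]

/-- `vBound` dominates an actual variance, which is nonnegative by Cauchy–Schwarz and `α² ≤ α`. -/
theorem RoundBounds.vBound_nonneg (h : RoundBounds nA α ω EL EU E2U q) (hα0 : 0 ≤ α)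
    (hα1 : α ≤ 1) : 0 ≤ vBound EL EU E2U := by
  refine le_trans ?_ h.variance_le
  have hcs : (∑ k, ω k * q k) ^ 2 ≤ ∑ k, ω k ^ 2 * q k := by
    have h0 : 0 ≤ ∑ k, (ω k - ∑ k, ω k * q k) ^ 2 * q k :=
      Finset.sum_nonneg fun k _ => mul_nonneg (sq_nonneg _) (h.nonneg k)
    set m := ∑ k, ω k * q k with hm
    have e : ∀ k, (ω k - m) ^ 2 * q k = ω k ^ 2 * q k - 2 * m * (ω k * q k) + m ^ 2 * q k :=
      fun k => by ring
    simp only [e, Finset.sum_add_distrib, Finset.sum_sub_distrib, ← Finset.mul_sum, h.sum_eq,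
      ← hm] at h0
    nlinarith
  have : α ^ 2 * (∑ k, ω k * q k) ^ 2 ≤ α * ∑ k, ω k ^ 2 * q k := by
    have h1 : α ^ 2 ≤ α := by nlinarith
    exact mul_le_mul h1 hcs (sq_nonneg _) hα0
  nlinarith

/-- The two entries of the maximum add up to `(omegaMax ω - omegaMin ω) + (EU - EL)`, whose first
term is positive because `ω` takes a nonzero value. -/
theorem RoundBounds.cBound_pos (h : RoundBounds nA α ω EL EU E2U q) (hω : ω ≠ 0) :
    0 < cBound ω EL EU := by
  obtain ⟨k, hk⟩ := Function.ne_iff.1 hω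
  have h0 : (0 : ℝ) ∈ chiValues ω := Finset.mem_insert_self _ _
  have h1 : ω k ∈ chiValues ω :=
    Finset.mem_insert_of_mem (Finset.mem_image_of_mem ω (Finset.mem_univ k))
  have a1 : 0 ≤ omegaMax ω := Finset.le_max' _ _ h0
  have a2 : ω k ≤ omegaMax ω := Finset.le_max' _ _ h1
  have a3 : omegaMin ω ≤ 0 := Finset.min'_le _ _ h0
  have a4 : omegaMin ω ≤ ω k := Finset.min'_le _ _ h1
  have hlt : omegaMin ω < omegaMax ω := by
    rcases lt_or_gt_of_ne hk with h' | h'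
    · exact lt_of_le_of_lt a4 (lt_of_lt_of_le h' a1)
    · exact lt_of_le_of_lt a3 (lt_of_lt_of_le h' a2)
  have hE := h.le_mean.trans h.mean_le
  rw [cBound]
  have b1 := le_max_left (omegaMax ω - EL) (EU - omegaMin ω)
  have b2 := le_max_right (omegaMax ω - EL) (EU - omegaMin ω)
  linarith

theorem RoundBounds.mgf_le (h : RoundBounds nA α ω EL EU E2U q) (hα0 : 0 ≤ α) (hα1 : α ≤ 1)
    (hω : ω ≠ 0) {t : ℝ} (ht : 0 ≤ t) (htc : t * cBound ω EL EU < 3) :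
    ∑ o : Bool × Fin nA, localWeight α o.1 * q o.2 * Real.exp (t * localValue ω o) ≤
      Real.exp (t * EU + vBound EL EU E2U * (t ^ 2 / (2 * (1 - t * cBound ω EL EU / 3)))) := by
  have hmean := sum_localWeight_mul_localValue α q ω one_ne_zero
  have hsq := sum_localWeight_mul_localValue α q ω two_ne_zero
  simp only [pow_one] at hmean
  refine VEP.mgf_le (EL := EL) _ _ (fun o => mul_nonneg ?_ (h.nonneg _)) ?_ ?_ ?_ ?_ ?_
    (h.cBound_pos hω).le ht htc
  · rw [localWeight]
    split_ifs <;> linarith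
  · have := sum_localWeight_mul α q fun _ => 1
    simp only [mul_one] at this
    rw [this, h.sum_eq]
    ring
  · rw [hmean]; exact h.le_mean
  · rw [hmean]; exact h.mean_le
  · rw [hmean, hsq]; exact h.variance_le
  · intro o
    exact (sub_le_sub_right (localValue_le_omegaMax ω o) _).trans (le_max_left _ _)

/-- The moment generating function of the contribution of one residue class. -/
theorem mgf_residueClass_le (hnA : 2 ≤ nA) {ε : ℝ} (hε0 : 0 ≤ ε) (hε1 : ε ≤ 1)
    (src : CorrelatedSource nA N L HC) (𝒞 : Channel HC HB N) (hα0 : 0 ≤ α) (hα1 : α ≤ 1)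
    (w : OrthonormalBasis (Fin nA) ℂ (EuclideanSpace ℂ (Fin nA))) (hω : ω ≠ 0)
    (hround : ∀ q : Fin nA → ℝ, (∀ k, 0 ≤ q k) → ∑ k, q k = 1 → (∃ G ∈ feasible src.φ,
      ∀ ω : Fin nA → ℝ,
        ((∑ k, (ω k : ℂ) • ketbra (w k)) * rhoA src.p (effectiveEps ε L) G).trace.re =
          ∑ k, ω k * q k) → RoundBounds nA α ω EL EU E2U q)
    {r : ℕ} (hr : r < L + 1) {t : ℝ} (ht : 0 ≤ t) (htc : t * cBound ω EL EU < 3) :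
    ∑ o : Fin N → Bool × Fin nA, Real.exp (t * ∑ u ∈ residueClass N L r, localValue ω (o u)) *
        localProb src ε 𝒞 α w o ≤
      Real.exp (t * EU + vBound EL EU E2U * (t ^ 2 / (2 * (1 - t * cBound ω EL EU / 3)))) ^
        (residueClass N L r).card := by
  classical
  set B := Real.exp (t * EU +
    vBound EL EU E2U * (t ^ 2 / (2 * (1 - t * cBound ω EL EU / 3)))) with hB
  let P : Fin N → Prop := fun u => (u : ℕ) % (L + 1) = r
  let g : Fin N → Bool × Fin nA → ℝ := fun u o =>
    if P u then Real.exp (t * localValue ω o) else 1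
  -- Alice's one-round operator with the exponential weight absorbed. By multilinearity the moment
  -- generating function is the expectation of the product of these operators. Outside the class `D
  -- u` is the identity, so there the weights are diagonal.
  let D : Fin N → Fin nA → Fin nA → ℂ := fun u a b =>
    ∑ o : Bool × Fin nA, (g u o : ℂ) * ((localWeight α o.1 : ℂ) * ketbra (w o.2) a b)
  let c0 : {u : Fin N // P u} → Fin nA := fun _ => ⟨0, by omega⟩
  choose q hq0 hq1 hq hqG using fun (u : {u : Fin N // P u}) (s : {u : Fin N // ¬ P u} → Fin nA) =>
    src.exists_outcome_law hε0 hε1 w u (mergeSettings r c0 s)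
  have hg : ∀ o : Fin N → Bool × Fin nA,
      Real.exp (t * ∑ u ∈ residueClass N L r, localValue ω (o u)) = ∏ u, g u (o u) := by
    intro o
    rw [Finset.mul_sum, Real.exp_sum, residueClass, Finset.prod_filter]
  have hD : ∀ u, ¬ P u → ∀ a b, D u a b * ((√(src.p a) * √(src.p b) : ℝ) : ℂ) =
      if a = b then ((src.p a : ℝ) : ℂ) else 0 := by
    intro u hu a b
    have : D u a b = if a = b then 1 else 0 := by
      simp only [D, g, if_neg hu, Complex.ofReal_one, one_mul]
      rw [Fintype.sum_prod_type, Fintype.sum_bool]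
      simp only [← Finset.mul_sum, ← Matrix.sum_apply, sum_ketbra, Matrix.one_apply, localWeight,
        if_true, Bool.false_eq_true, if_false]
      split_ifs
      · push_cast; ring
      · simp
    rw [this]
    split_ifs with hab
    · rw [hab, Real.mul_self_sqrt (src.p_nonneg b), one_mul]
    · simp
  have hfac : ∀ u s, ∑ a, ∑ b, D (u : {u : Fin N // P u}) a b *
      ((√(src.p a) * √(src.p b) : ℝ) : ℂ) * src.blockOverlap ε u (mergeSettings r c0 s) a b =
        ((∑ o : Bool × Fin nA, localWeight α o.1 * q u s o.2 *
          Real.exp (t * localValue ω o) : ℝ) : ℂ) := by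
    intro u s
    push_cast
    simp only [D, Finset.sum_mul]
    rw [Finset.sum_congr rfl fun a _ => Finset.sum_comm, Finset.sum_comm]
    refine Finset.sum_congr rfl fun o _ => ?_
    rw [← hq, Finset.mul_sum, Finset.sum_mul]
    refine Finset.sum_congr rfl fun a _ => ?_
    rw [Finset.mul_sum, Finset.sum_mul]
    refine Finset.sum_congr rfl fun b _ => ?_
    simp only [g, if_pos u.2]
    push_cast
    ring
  have hsum : ((∑ o : Fin N → Bool × Fin nA,
      Real.exp (t * ∑ u ∈ residueClass N L r, localValue ω (o u)) *
        localProb src ε 𝒞 α w o : ℝ)) =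
      ∑ s : {u : Fin N // ¬ P u} → Fin nA, (∏ v, src.p (s v)) *
        ∏ u : {u : Fin N // P u}, ∑ o : Bool × Fin nA, localWeight α o.1 * q u s o.2 *
          Real.exp (t * localValue ω o) := by
    have h1 : ∑ o : Fin N → Bool × Fin nA, ((∏ u, g u (o u) : ℝ) : ℂ) *
        bornFunctional src ε 𝒞 (fun u => localOperator α w (o u)) =
        bornFunctional src ε 𝒞 (fun u a b => D u a b • 1) := by
      have h2 : (fun (u : Fin N) (a b : Fin nA) => D u a b • (1 : HB →L[ℂ] HB)) =
          fun u => ∑ o, (g u o : ℂ) • localOperator α w o := by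
        funext u a b
        rw [Finset.sum_apply, Finset.sum_apply]
        simp only [D, Finset.sum_smul, Pi.smul_apply, localOperator, smul_smul]
      rw [h2, MultilinearMap.map_sum]
      refine Finset.sum_congr rfl fun o _ => ?_
      rw [Complex.ofReal_prod]
      exact ((bornFunctional src ε 𝒞).map_smul_univ _ _).symm
    rw [bornFunctional_smul_one] at h1
    have h4 : ∀ i j : Fin N → Fin nA,
        (∏ u, D u (i u) (j u)) * ⟪src.globalState ε i, src.globalState ε j⟫_ℂ =
          (∏ u, D u (i u) (j u) * ((√(src.p (i u)) * √(src.p (j u)) : ℝ) : ℂ)) *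
            ∏ v, ⟪src.emitted ε v i, src.emitted ε v j⟫_ℂ := by
      intro i j
      rw [inner_globalState, ← mul_assoc, Finset.prod_mul_distrib]
    simp only [h4] at h1
    rw [sum_sum_factorize P (fun u a b => D u a b * ((√(src.p a) * √(src.p b) : ℝ) : ℂ))
      (fun i j => ∏ v, ⟪src.emitted ε v i, src.emitted ε v j⟫_ℂ)
      (fun _ a => ((src.p a : ℝ) : ℂ))
      (fun u s a b => src.blockOverlap ε u (mergeSettings r c0 s) a b) hD
      (fun a b s => prod_inner_emitted src hε0 hε1 hr a b c0 s)] at h1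
    simp only [hfac, ← Complex.ofReal_prod, ← Complex.ofReal_mul, ← Complex.ofReal_sum] at h1
    have h3 := congrArg Complex.re h1
    rw [Complex.ofReal_re, Complex.re_sum] at h3
    rw [← h3]
    refine Finset.sum_congr rfl fun o _ => ?_
    rw [Complex.re_ofReal_mul, hg]
    rfl
  rw [hsum]
  have hcard : (residueClass N L r).card = Fintype.card {u : Fin N // P u} := by
    rw [Fintype.card_subtype]; rfl
  have hwt : ∀ f : Bool, 0 ≤ localWeight α f := by
    intro f
    rw [localWeight]
    split_ifs <;> linarith
  calc _ ≤ ∑ s : {u : Fin N // ¬ P u} → Fin nA, (∏ v, src.p (s v)) *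
        ∏ _u : {u : Fin N // P u}, B := by
        refine Finset.sum_le_sum fun s _ => mul_le_mul_of_nonneg_left ?_
          (Finset.prod_nonneg fun v _ => src.p_nonneg _)
        refine Finset.prod_le_prod (fun u _ => Finset.sum_nonneg fun o _ => ?_) fun u _ => ?_
        · exact mul_nonneg (mul_nonneg (hwt _) (hq0 u s _)) (Real.exp_pos _).le
        · exact (hround _ (hq0 u s) (hq1 u s) (hqG u s)).mgf_le hα0 hα1 hω ht htc
    _ = B ^ (residueClass N L r).card := by
        rw [← Finset.sum_mul, Finset.prod_const, Finset.card_univ, hcard]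
        have : ∑ s : {u : Fin N // ¬ P u} → Fin nA, ∏ v, src.p (s v) = 1 := by
          have h := Finset.prod_univ_sum
            (fun _ : {u : Fin N // ¬ P u} => (Finset.univ : Finset (Fin nA))) fun _ a => src.p a
          rw [Fintype.piFinset_univ] at h
          rw [← h, Finset.prod_congr rfl fun _ _ => src.p_sum, Finset.prod_const_one]
        rw [this, one_mul]

end Mgf

/-! ### Markov's inequality in each class, and the union over the classes. -/

section Tail

variable {nA nM N L : ℕ} {HC : Type u} {HB : Type v}
  [NormedAddCommGroup HC] [InnerProductSpace ℂ HC]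
  [NormedAddCommGroup HB] [InnerProductSpace ℂ HB] [CompleteSpace HB]
  {α : ℝ} {ω : Fin nA → ℝ} {EL EU E2U : ℝ}

/-- The tail bound for every threshold above the mean bound `N E^U` plus the deviation. -/
theorem prob_le_of_threshold (hnA : 2 ≤ nA) (hN : 1 ≤ N) {ε : ℝ} (hε0 : 0 ≤ ε) (hε1 : ε ≤ 1)
    (src : CorrelatedSource nA N L HC) (bob : BobDevice nM HB) (𝒞 : Channel HC HB N)
    (hα0 : 0 ≤ α) (hα1 : α ≤ 1)
    (w : OrthonormalBasis (Fin nA) ℂ (EuclideanSpace ℂ (Fin nA))) (hω : ω ≠ 0)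
    (hround : ∀ q : Fin nA → ℝ, (∀ k, 0 ≤ q k) → ∑ k, q k = 1 → (∃ G ∈ feasible src.φ,
      ∀ ω : Fin nA → ℝ,
        ((∑ k, (ω k : ℂ) • ketbra (w k)) * rhoA src.p (effectiveEps ε L) G).trace.re =
          ∑ k, ω k * q k) → RoundBounds nA α ω EL EU E2U q)
    {εpB T : ℝ} (hεpB : 0 < εpB)
    (hT : N * EU + (L + 1) * Nbar N L * deltaB N L ω EL EU E2U εpB ≤ T) :
    prob hnA src ε bob 𝒞 α w {o | T ≤ MW ω o} ≤ εpB := by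
  classical
  rw [prob_eq_sum_localProb]
  set Δ := deltaB N L ω EL EU E2U εpB with hΔ
  set c := cBound ω EL EU with hc
  set V := vBound EL EU E2U with hV
  have hP0 := localProb_nonneg src ε 𝒞 hα0 hα1 w
  rcases le_or_gt 1 εpB with h1 | h1
  -- At `t = 0` the bound says that the total probability is at most `1`, which settles `εpB ≥ 1`,
  -- where the logarithm need not be positive.
  · have h := mgf_residueClass_le hnA hε0 hε1 src 𝒞 hα0 hα1 w hω hround (Nat.succ_pos L)
      (le_refl 0) (by simp)
    simp only [zero_mul, Real.exp_zero, one_mul, ne_eq, OfNat.ofNat_ne_zero, not_false_eq_true,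
      zero_pow, zero_div, mul_zero, add_zero, one_pow] at h
    refine le_trans ?_ (h.trans h1)
    exact Finset.sum_le_sum_of_subset_of_nonneg (Finset.filter_subset _ _) fun o _ _ => hP0 o
  -- One actual round law suffices to see that `c > 0` and `V ≥ 0`.
  · obtain ⟨q, hq0, hq1, -, hqG⟩ := src.exists_outcome_law hε0 hε1 w ⟨0, hN⟩
      fun _ => ⟨0, by omega⟩
    have hb := hround q hq0 hq1 hqG
    have hcpos : 0 < c := hb.cBound_pos hω
    have hV0 : 0 ≤ V := hb.vBound_nonneg hα0 hα1
    have hNbar : 0 < Nbar N L := by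
      have := le_mul_Nbar N L
      by_contra h0
      have : Nbar N L = 0 := by omega
      simp_all
    have hn : (0 : ℝ) < Nbar N L := by exact_mod_cast hNbar
    have hL : (0 : ℝ) < (L : ℝ) + 1 := by positivity
    have hℓ : 0 < Real.log (((L : ℝ) + 1) / εpB) := by
      apply Real.log_pos
      rw [one_lt_div hεpB]
      have : (0 : ℝ) ≤ L := Nat.cast_nonneg L
      linarith
    obtain ⟨t, ht, htc, hexp⟩ := exists_bernstein_parameter hcpos hV0 hℓ hn
      (Δ := Δ) (by rw [hΔ, deltaB])
    set g := t ^ 2 / (2 * (1 - t * c / 3)) with hg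
    have hg0 : 0 ≤ V * g := by
      have : 0 < 1 - t * c / 3 := by linarith
      positivity
    let n : ℕ → ℝ := fun r => (residueClass N L r).card
    let S : ℕ → (Fin N → Bool × Fin nA) → ℝ := fun r o =>
      ∑ u ∈ residueClass N L r, localValue ω (o u)
    -- The threshold of class `r` counts the mean with the true class size and the deviation with
    -- `Nbar`. These add up to at most `T`, whatever the sign of `EU`, so some class reaches its own
    -- threshold.
    have hpt : ∀ o : Fin N → Bool × Fin nA, T ≤ ∑ u, localValue ω (o u) →
        1 ≤ ∑ r ∈ Finset.range (L + 1),
          Real.exp (-(t * (n r * EU + Nbar N L * Δ))) * Real.exp (t * S r o) := by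
      intro o ho
      have hsum1 : ∑ r ∈ Finset.range (L + 1), S r o = ∑ u, localValue ω (o u) :=
        sum_residueClasses L fun u => localValue ω (o u)
      have hsum2 : ∑ r ∈ Finset.range (L + 1), n r = N := by
        have := sum_residueClasses (N := N) L fun _ => 1
        simpa [n] using this
      have hsum3 : ∑ r ∈ Finset.range (L + 1), (n r * EU + Nbar N L * Δ) ≤
          ∑ r ∈ Finset.range (L + 1), S r o := by
        rw [hsum1, Finset.sum_add_distrib, ← Finset.sum_mul, hsum2, Finset.sum_const,
          Finset.card_range, nsmul_eq_mul]
        push_cast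
        linarith
      obtain ⟨r, hr, hle⟩ := Finset.exists_le_of_sum_le (by simp) hsum3
      refine le_trans ?_ (Finset.single_le_sum (f := fun r =>
        Real.exp (-(t * (n r * EU + Nbar N L * Δ))) * Real.exp (t * S r o))
        (fun r _ => by positivity) hr)
      rw [← Real.exp_add]
      apply Real.one_le_exp
      nlinarith [mul_le_mul_of_nonneg_left hle ht]
    have hclass : ∀ r ∈ Finset.range (L + 1),
        ∑ o : Fin N → Bool × Fin nA,
          Real.exp (-(t * (n r * EU + Nbar N L * Δ))) * Real.exp (t * S r o) *
            localProb src ε 𝒞 α w o ≤ εpB / (L + 1) := by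
      intro r hr
      have h := mgf_residueClass_le hnA hε0 hε1 src 𝒞 hα0 hα1 w hω hround
        (Finset.mem_range.1 hr) ht htc
      simp only [mul_assoc]
      rw [← Finset.mul_sum]
      refine (mul_le_mul_of_nonneg_left h (Real.exp_pos _).le).trans ?_
      rw [← Real.exp_nat_mul, ← Real.exp_add]
      have hle : (n r : ℝ) ≤ Nbar N L := Nat.cast_le.2 (card_residueClass_le N L r)
      have hln : εpB / (L + 1) = Real.exp (-Real.log (((L : ℝ) + 1) / εpB)) := by
        rw [Real.exp_neg, Real.exp_log (by positivity), inv_div]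
      rw [hln]
      apply Real.exp_le_exp.2
      refine le_trans ?_ hexp
      -- The mean terms cancel exactly; the class size is enlarged to `Nbar` only in the variance
      -- term, which is nonnegative.
      have := mul_le_mul_of_nonneg_right hle hg0
      change -(t * (n r * EU + Nbar N L * Δ)) + n r * (t * EU + V * g) ≤ _
      nlinarith
    calc ∑ o with T ≤ ∑ u, localValue ω (o u), localProb src ε 𝒞 α w o
        ≤ ∑ o : Fin N → Bool × Fin nA, ∑ r ∈ Finset.range (L + 1),
          Real.exp (-(t * (n r * EU + Nbar N L * Δ))) * Real.exp (t * S r o) *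
            localProb src ε 𝒞 α w o := by
          rw [Finset.sum_filter]
          refine Finset.sum_le_sum fun o _ => ?_
          rw [← Finset.sum_mul]
          split_ifs with ho
          · exact le_mul_of_one_le_left (hP0 o) (hpt o ho)
          · exact mul_nonneg (Finset.sum_nonneg fun r _ => by positivity) (hP0 o)
      _ ≤ ∑ r ∈ Finset.range (L + 1), εpB / (L + 1) := by
          rw [Finset.sum_comm]
          exact Finset.sum_le_sum hclass
      _ = εpB := by
          rw [Finset.sum_const, Finset.card_range, nsmul_eq_mul]
          push_cast
          field_simp

end Tail

end VEP

end

theorem theorem1 {nA nM N L : ℕ} (hnA : 2 ≤ nA) (hN : 1 ≤ N)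
    {HC : Type*} [NormedAddCommGroup HC] [InnerProductSpace ℂ HC] [CompleteSpace HC]
    {HB : Type*} [NormedAddCommGroup HB] [InnerProductSpace ℂ HB] [CompleteSpace HB]
    (ε : ℝ) (hε0 : 0 ≤ ε) (hε1 : ε ≤ 1) (src : VEP.CorrelatedSource nA N L HC)
    (bob : VEP.BobDevice nM HB) (𝒞 : VEP.Channel HC HB N)
    (α : ℝ) (hα0 : 0 ≤ α) (hα1 : α ≤ 1)
    -- the nonzero observable `W = ∑ ω |ω⟩⟨ω|`, with an orthonormal eigenbasis `w`
    (W : Matrix (Fin nA) (Fin nA) ℂ) (hW : W ≠ 0)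
    (ω : Fin nA → ℝ) (w : OrthonormalBasis (Fin nA) ℂ (EuclideanSpace ℂ (Fin nA)))
    (hspec : W = ∑ k, (ω k : ℂ) • VEP.ketbra (w k))
    (EL EU E2U : ℝ)
    (hEL : ∀ G ∈ VEP.feasible src.φ,
      EL ≤ α * (W * VEP.rhoA src.p (VEP.effectiveEps ε L) G).trace.re)
    (hEU : ∀ G ∈ VEP.feasible src.φ,
      α * (W * VEP.rhoA src.p (VEP.effectiveEps ε L) G).trace.re ≤ EU)
    (hE2U : ∀ G ∈ VEP.feasible src.φ,
      α * (W ^ 2 * VEP.rhoA src.p (VEP.effectiveEps ε L) G).trace.re ≤ E2U)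
    (εpB : ℝ) (hεpB : 0 < εpB) :
    ((0 ≤ EU ∨ (L + 1) ∣ N) →
      VEP.prob hnA src ε bob 𝒞 α w
        {o | VEP.MWU N L ω EL EU E2U εpB ≤ VEP.MW ω o} ≤ εpB) ∧
    (EU < 0 →
      VEP.prob hnA src ε bob 𝒞 α w
        {o | N * EU + (L + 1) * VEP.Nbar N L * VEP.deltaB N L ω EL EU E2U εpB ≤ VEP.MW ω o}
        ≤ εpB) := by
  have hω : ω ≠ 0 := by
    rintro rfl
    apply hW
    rw [hspec]
    simp
  have hround : ∀ q : Fin nA → ℝ, (∀ k, 0 ≤ q k) → ∑ k, q k = 1 →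
      (∃ G ∈ VEP.feasible src.φ, ∀ ω : Fin nA → ℝ,
        ((∑ k, (ω k : ℂ) • VEP.ketbra (w k)) *
          VEP.rhoA src.p (VEP.effectiveEps ε L) G).trace.re = ∑ k, ω k * q k) →
      VEP.RoundBounds nA α ω EL EU E2U q := by
    rintro q hq0 hq1 ⟨G, hG, htr⟩
    have h1 := htr ω
    have h2 := htr fun k => ω k ^ 2
    rw [← VEP.sq_sum_smul_ketbra, ← hspec] at h2
    rw [← hspec] at h1
    exact ⟨hq0, hq1, h1 ▸ hEL G hG, h1 ▸ hEU G hG, h2 ▸ hE2U G hG⟩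
  refine ⟨fun h => ?_, fun _ => ?_⟩
  · refine VEP.prob_le_of_threshold hnA hN hε0 hε1 src bob 𝒞 hα0 hα1 w hω hround hεpB ?_
    rw [VEP.MWU, mul_add]
    refine add_le_add ?_ le_rfl
    rcases h with h | h
    -- `MWU` replaces `N` by `(L + 1) * Nbar N L ≥ N` in the mean term. This raises the threshold if
    -- `EU ≥ 0` and changes nothing if `L + 1` divides `N`.
    · refine mul_le_mul_of_nonneg_right ?_ h
      exact_mod_cast VEP.le_mul_Nbar N L
    · refine le_of_eq ?_
      congr 1
      exact_mod_cast (VEP.mul_Nbar_of_dvd h).symm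
  · exact VEP.prob_le_of_threshold hnA hN hε0 hε1 src bob 𝒞 hα0 hα1 w hω hround hεpB le_rfl
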